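/- Let $\mathbb{T}^2=\mathbb{R}^2/\mathbb{Z}^2$. For $\eta\in(0,1)$ let $\mathcal{C}^\eta(\mathbb{T}^2)$ denote the separable Hölder–Besov space, i.e. the closure of $C^\infty(\mathbb{T}^2)$ in the Hölder norm $$\|f\|_\eta=\sup_{x}|f(x)|+\sup_{x\neq y}\frac{|f(x)-f(y)|}{|x-y|^\eta}.$$ Let $T>0$, let $\eta\in(0,1)$, let $g\in C_b^1(\mathbb{R})$ (that is, $g:\mathbb{R}\to\mathbb{R}$ is continuously differentiable and $g,g'$ are bounded), let $u_0\in\mathcal{C}^\eta(\mathbb{T}^2)$ and $h\in L^2(\mathbb{T}^2)$. Then there exists a unique $w_h\in C([0,T];\mathcal{C}^\eta(\mathbb{T}^2))$ with $w_h(0,\cdot)=u_0$ which solves $$(\partial_t-\Delta)w_h=g(w_h)\,h\qquad\text{on }[0,T]\times\mathbb{T}^2$$ in the sense of distributions, that is, for every $\varphi\in C^\infty(\mathbb{T}^2)$ and every $t\in[0,T]$, $$\int_{\mathbb{T}^2}w_h(t,x)\varphi(x)\,dx=\int_{\mathbb{T}^2}u_0(x)\varphi(x)\,dx+\int_0^t\int_{\mathbb{T}^2}\Big(w_h(s,x)\,\Delta\varphi(x)+g(w_h(s,x))\,h(x)\,\varphi(x)\Big)\,dx\,ds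 .$$ In particular the solution is global: $T>0$ is arbitrary. -/

import Mathlib

open MeasureTheory Set Filter Topology
open scoped NNReal ENNReal ContDiff

namespace DetGPAM

/-- The two-dimensional torus `𝕋² = ℝ² / ℤ²`. Its measure `volume` is normalised Lebesgue measure. -/
abbrev Torus2 : Type := Fin 2 → UnitAddCircle

/-- The projection `ℝ² → 𝕋²`. -/
def toTorus (y : Fin 2 → ℝ) : Torus2 := fun i => (y i : UnitAddCircle)

/-- `φ ∈ C^∞(𝕋²)`: the periodic lift of `φ` to `ℝ²` is infinitely differentiable. -/
def IsSmooth (φ : Torus2 → ℝ) : Prop :=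
  ContDiff ℝ ∞ (fun y : Fin 2 → ℝ => φ (toTorus y))

/-- The Laplacian on `𝕋²`: the sum of the second derivatives along the two coordinate axes. -/
noncomputable def laplacian (φ : Torus2 → ℝ) (x : Torus2) : ℝ :=
  ∑ i : Fin 2, iteratedDeriv 2 (fun s : ℝ => φ (x + toTorus (Pi.single i s))) 0

/-- The Hölder norm `‖f‖_η = sup |f| + [f]_η`, with value `∞` if `f` is not `η`-Hölder. -/
noncomputable def holderNorm (η : ℝ≥0) (f : Torus2 → ℝ) : ℝ≥0∞ :=
  (⨆ x, ‖f x‖ₑ) + eHolderNorm η f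

/-- The separable Hölder–Besov space `𝒞^η(𝕋²)`: the closure of `C^∞(𝕋²)` in the `η`-Hölder norm. -/
def HolderSpace (η : ℝ≥0) : Set (Torus2 → ℝ) :=
  {f | ∀ ε : ℝ≥0∞, 0 < ε → ∃ φ : Torus2 → ℝ, IsSmooth φ ∧ holderNorm η (f - φ) < ε}

/-- `w ∈ C([0,T]; 𝒞^η(𝕋²))`; only the values `w t` with `t ∈ [0,T]` matter. -/
def IsContinuousCurve (T : ℝ) (η : ℝ≥0) (w : ℝ → Torus2 → ℝ) : Prop :=
  (∀ t ∈ Icc 0 T, w t ∈ HolderSpace η) ∧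
  ∀ t ∈ Icc 0 T, Tendsto (fun s => holderNorm η (w s - w t)) (𝓝[Icc 0 T] t) (𝓝 0)

/-- `g ∈ C_b¹(ℝ)`: `g` is continuously differentiable, and `g` and `g'` are bounded. -/
def IsCb1 (g : ℝ → ℝ) : Prop :=
  ContDiff ℝ 1 g ∧ ∃ M : ℝ, ∀ y, |g y| ≤ M ∧ |deriv g y| ≤ M

/-- `w` belongs to `C([0,T]; 𝒞^η(𝕋²))`, satisfies `w 0 = u₀`, and solves `(∂ₜ - Δ) w = g(w) h` on
`[0,T] × 𝕋²` in the sense of distributions: the equation, integrated in time, holds at every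
`t ∈ [0,T]` against every test function `φ ∈ C^∞(𝕋²)`. -/
def IsSolution (T : ℝ) (η : ℝ≥0) (g : ℝ → ℝ) (u₀ : Torus2 → ℝ)
    (h : Lp ℝ 2 (volume : Measure Torus2)) (w : ℝ → Torus2 → ℝ) : Prop :=
  IsContinuousCurve T η w ∧ w 0 = u₀ ∧
  ∀ φ : Torus2 → ℝ, IsSmooth φ → ∀ t ∈ Icc 0 T,
    ∫ x, w t x * φ x = (∫ x, u₀ x * φ x) +
      ∫ s in (0 : ℝ)..t, ∫ x, (w s x * laplacian φ x + g (w s x) * h x * φ x)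

end DetGPAM

/-!
The equation is equivalent to its mild form
`w(t) = e^{tΔ} u₀ + ∫₀ᵗ e^{rΔ} (g(w(t - r)) h) dr`,
which is a Volterra equation with an integrable singularity at `r = 0`.

*Smoothing.* On Fourier coefficients `e^{rΔ}` is multiplication by `e^{-λₙ r}` with `λₙ = |2πn|²`.
In dimension two, Cauchy-Schwarz over the frequencies bounds `∑ₙ (1 + |n|)^η e^{-λₙ r} |f̂(n)|` by
`C r^{-(3 + η)/4} ‖f‖_{L²}`, and `(3 + η)/4 < 1` because `η < 1`
(`summable_heatSeq_and_tsum_le`, `isSmoothingFamily_heatOp`). So `e^{rΔ}` maps `L²` to a weighted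
Wiener algebra (`WienerSeq`), every element of which is a limit of trigonometric polynomials in the
`η`-Hölder norm (`holderNorm_synth_le`, `synth_mem_holderSpace`).

*Fixed point.* `w ↦ g(w) h` is Lipschitz from continuous functions to `L²`
(`lipschitzWith_nemytskii`), since `g'` is bounded. In the norm `sup_t e^{-βt} ‖w(t)‖_∞` with `β`
large the mild equation is therefore a contraction on all of `[0, T]`, for every `T`, which gives
existence and uniqueness among continuous curves of continuous functions
(`IsSmoothingFamily.existsUnique_volterra`). The Duhamel term is continuous in time with values in
the Wiener algebra (`IsSmoothingFamily.continuousOn_duhamel`), hence in the Hölder space.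

*Initial datum.* `e^{tΔ} u₀` is written as a Gaussian average of translates of `u₀`, which makes it
a contraction in the Hölder norm; continuity in time follows for smooth functions by interpolation
and for the whole space by density (`tendsto_holderNorm_heatFlow_sub`).

*Equivalence of the formulations.* Testing with the real and imaginary parts of exponentials turns
the weak equation into a scalar linear equation for each Fourier coefficient, which Duhamel's
formula solves (`WeakEq.modeEq`, `duhamel_scalar_iff`, `modeEq_iff_mild`). Conversely, Parseval's
identity recovers the equation for all smooth test functions from its Fourier coefficients
(`ModeEq.weakEq`). The fixed point problem is posed for complex-valued functions with right-hand
side `g(Re w) h`; its real part is the solution.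
-/

namespace DetGPAM

/-! ### Volterra equations with an integrable singularity -/

section Volterra

variable {H A X : Type*} [NormedAddCommGroup H] [NormedSpace ℝ H]
  [NormedAddCommGroup A] [NormedSpace ℝ A]
  [NormedAddCommGroup X] [NormedSpace ℝ X]

/-- A family of bounded operators `S r : H → A`, `0 < r ≤ T`, whose norms are dominated by an
integrable function `K`. A singularity at `r = 0` is allowed; this is what a smoothing semigroup
looks like. -/
structure IsSmoothingFamily (T : ℝ) (S : ℝ → H →L[ℝ] A) (K : ℝ → ℝ) : Prop where
  integrableOn : IntegrableOn K (Ioc 0 T)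
  norm_le : ∀ r ∈ Ioc 0 T, ‖S r‖ ≤ K r
  aestronglyMeasurable : ∀ G : ℝ → H, Continuous G →
    AEStronglyMeasurable (fun r => S r (G r)) (volume.restrict (Ioc 0 T))

/-- The Duhamel integral `∫₀ᵗ S(r) F(t - r) dr`. -/
noncomputable def duhamel (S : ℝ → H →L[ℝ] A) (F : ℝ → H) (t : ℝ) : A :=
  ∫ r in (0 : ℝ)..t, S r (F (t - r))

variable {T : ℝ} {S : ℝ → H →L[ℝ] A} {K : ℝ → ℝ}

namespace IsSmoothingFamily

lemma nonneg (hS : IsSmoothingFamily T S K) {r : ℝ} (hr : r ∈ Ioc 0 T) : 0 ≤ K r :=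
  (norm_nonneg _).trans (hS.norm_le r hr)

lemma integrableOn_apply (hS : IsSmoothingFamily T S K) {G : ℝ → H} (hG : Continuous G) :
    IntegrableOn (fun r => S r (G r)) (Ioc 0 T) := by
  obtain ⟨C, hC⟩ := (isCompact_Icc (a := (0 : ℝ)) (b := T)).exists_bound_of_continuousOn
    hG.continuousOn
  refine Integrable.mono' (hS.integrableOn.mul_const C) (hS.aestronglyMeasurable G hG) ?_
  filter_upwards [ae_restrict_mem measurableSet_Ioc] with r hr
  exact (S r).le_of_opNorm_le_of_le (hS.norm_le r hr) (hC r (Ioc_subset_Icc_self hr))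

lemma intervalIntegrable_apply (hS : IsSmoothingFamily T S K) {G : ℝ → H} (hG : Continuous G)
    {t : ℝ} (ht : t ∈ Icc 0 T) : IntervalIntegrable (fun r => S r (G r)) volume 0 t := by
  rw [intervalIntegrable_iff_integrableOn_Ioc_of_le ht.1]
  exact (hS.integrableOn_apply hG).mono_set (Ioc_subset_Ioc_right ht.2)

/-- The Duhamel integral of a continuous function is continuous in time: written as an integral
over the fixed interval `(0, T]`, its integrand is continuous in `t` except where `r = t`. -/
lemma continuousOn_duhamel (hS : IsSmoothingFamily T S K) {F : ℝ → H} (hF : Continuous F) :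
    ContinuousOn (duhamel S F) (Icc 0 T) := by
  have heq : EqOn (duhamel S F) (fun t => ∫ r in Ioc 0 T,
      (Iic t).indicator (fun r => S r (F (t - r))) r) (Icc 0 T) := by
    intro t ht
    simp only [duhamel]
    rw [intervalIntegral.integral_of_le ht.1, setIntegral_indicator measurableSet_Iic]
    congr 2
    ext r
    simp only [mem_Ioc, mem_inter_iff, mem_Iic]
    exact ⟨fun h => ⟨⟨h.1, h.2.trans ht.2⟩, h.2⟩, fun h => ⟨h.1.1, h.2⟩⟩
  refine ContinuousOn.congr ?_ heq
  obtain ⟨C, hC⟩ := (isCompact_Icc (a := (0 : ℝ)) (b := T)).exists_bound_of_continuousOn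
    hF.continuousOn
  intro t₀ ht₀
  refine continuousWithinAt_of_dominated (bound := fun r => K r * C) ?_ ?_
    (hS.integrableOn.mul_const C) ?_
  · refine Eventually.of_forall fun t => ?_
    exact (hS.aestronglyMeasurable (fun r => F (t - r)) (by fun_prop)).indicator measurableSet_Iic
  · filter_upwards [self_mem_nhdsWithin] with t ht
    filter_upwards [ae_restrict_mem measurableSet_Ioc] with r hr
    by_cases hrt : r ∈ Iic t
    · rw [indicator_of_mem hrt]
      exact (S r).le_of_opNorm_le_of_le (hS.norm_le r hr)
        (hC _ ⟨sub_nonneg.2 hrt, by linarith [ht.2, hr.1]⟩)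
    · rw [indicator_of_notMem hrt, norm_zero]
      exact mul_nonneg (hS.nonneg hr)
        ((norm_nonneg _).trans (hC 0 ⟨le_rfl, ht₀.1.trans ht₀.2⟩))
  · have hne : ∀ᵐ r ∂(volume.restrict (Ioc 0 T)), r ≠ t₀ :=
      ae_restrict_of_ae (Measure.ae_ne volume t₀)
    filter_upwards [hne] with r hr
    have hcont : Continuous fun t => S r (F (t - r)) := by fun_prop
    refine ContinuousAt.continuousWithinAt ?_
    rcases lt_or_gt_of_ne hr with h | h
    · refine hcont.continuousAt.congr ?_
      filter_upwards [lt_mem_nhds h] with t ht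
      rw [indicator_of_mem (show r ∈ Iic t from ht.le)]
    · refine (continuousAt_const (y := (0 : A))).congr ?_
      filter_upwards [gt_mem_nhds h] with t ht
      rw [indicator_of_notMem (show r ∉ Iic t from not_le.2 ht)]

/-- The exponentially weighted mass of `K` is eventually small. -/
lemma exists_weight (hS : IsSmoothingFamily T S K) {ε : ℝ} (hε : 0 < ε) :
    ∃ β : ℝ, ∫ r in Ioc 0 T, K r * Real.exp (-β * r) < ε := by
  have hlim : Tendsto (fun n : ℕ => ∫ r in Ioc 0 T, K r * Real.exp (-(n : ℝ) * r)) atTop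
      (𝓝 (∫ r in Ioc 0 T, (0 : ℝ))) := by
    refine tendsto_integral_of_dominated_convergence (fun r => K r) ?_ hS.integrableOn ?_ ?_
    · intro n
      exact hS.integrableOn.aestronglyMeasurable.mul
        (by fun_prop : Continuous fun r : ℝ => Real.exp (-(n : ℝ) * r)).aestronglyMeasurable
    · intro n
      filter_upwards [ae_restrict_mem measurableSet_Ioc] with r hr
      rw [norm_mul, Real.norm_of_nonneg (hS.nonneg hr), Real.norm_of_nonneg (Real.exp_pos _).le]
      refine mul_le_of_le_one_right (hS.nonneg hr) (Real.exp_le_one_iff.2 ?_)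
      have := mul_nonneg (Nat.cast_nonneg (α := ℝ) n) hr.1.le
      linarith
    · filter_upwards [ae_restrict_mem measurableSet_Ioc] with r hr
      have h1 : Tendsto (fun n : ℕ => (n : ℝ) * r) atTop atTop :=
        tendsto_natCast_atTop_atTop.atTop_mul_const hr.1
      have h2 := (Real.tendsto_exp_neg_atTop_nhds_zero.comp h1).const_mul (K r)
      simpa [Function.comp_def] using h2
  rw [integral_zero] at hlim
  obtain ⟨n, hn⟩ := (hlim.eventually (gt_mem_nhds hε)).exists
  exact ⟨n, hn⟩

/-- Gronwall-type estimate for the Duhamel integral in an exponentially weighted supremum norm. -/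
lemma norm_duhamel_sub_le (hS : IsSmoothingFamily T S K) {F G : ℝ → H} (hF : Continuous F)
    (hG : Continuous G) {β M : ℝ}
    (hFG : ∀ s ∈ Icc 0 T, ‖F s - G s‖ ≤ M * Real.exp (β * s)) {t : ℝ} (ht : t ∈ Icc 0 T) :
    ‖duhamel S F t - duhamel S G t‖ ≤
      M * Real.exp (β * t) * ∫ r in Ioc 0 T, K r * Real.exp (-β * r) := by
  have hM : 0 ≤ M := by
    have := (norm_nonneg _).trans (hFG t ht)
    exact nonneg_of_mul_nonneg_left this (Real.exp_pos _)
  have hint : IntegrableOn (fun r => K r * Real.exp (-β * r)) (Ioc 0 T) := by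
    have h1 : IntegrableOn K (Icc 0 T) :=
      (integrableOn_Icc_iff_integrableOn_Ioc (by simp)).2 hS.integrableOn
    exact (h1.mul_continuousOn (by fun_prop) isCompact_Icc).mono_set Ioc_subset_Icc_self
  rw [duhamel, duhamel, ← intervalIntegral.integral_sub
    (hS.intervalIntegrable_apply (G := fun r => F (t - r)) (by fun_prop) ht)
    (hS.intervalIntegrable_apply (G := fun r => G (t - r)) (by fun_prop) ht),
    intervalIntegral.integral_of_le ht.1, ← integral_const_mul]
  have hsub : Ioc 0 t ⊆ Ioc 0 T := Ioc_subset_Ioc_right ht.2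
  calc _ ≤ ∫ r in Ioc 0 t, M * Real.exp (β * t) * (K r * Real.exp (-β * r)) := by
        refine norm_integral_le_of_norm_le ((hint.mono_set hsub).const_mul _) ?_
        filter_upwards [ae_restrict_mem measurableSet_Ioc] with r hr
        rw [← map_sub]
        refine ((S r).le_of_opNorm_le_of_le (hS.norm_le r (hsub hr))
          (hFG (t - r) ⟨sub_nonneg.2 hr.2, by linarith [ht.2, hr.1]⟩)).trans (le_of_eq ?_)
        rw [show β * (t - r) = β * t + -β * r by ring, Real.exp_add]
        ring
    _ ≤ _ := by
        refine setIntegral_mono_set (hint.const_mul _) ?_ hsub.eventuallyLE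
        filter_upwards [ae_restrict_mem measurableSet_Ioc] with r hr
        have := hS.nonneg hr
        simp only [Pi.zero_apply]
        positivity

/-- The Volterra equation `w = U + J ∫₀ᵗ S(r) N(w(t - r)) dr` with Lipschitz `N` and an integrable
singularity has exactly one continuous solution on `[0, T]`, for every `T`. In the norm
`sup e^{-βt} ‖w t‖` with `β` large the right-hand side is a contraction. -/
theorem existsUnique_volterra [CompleteSpace X] (hS : IsSmoothingFamily T S K) (hT : 0 ≤ T)
    {N : X → H} {L : ℝ≥0} (hN : LipschitzWith L N) (J : A →L[ℝ] X) (U : C(Icc 0 T, X)) :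
    ∃! w : C(Icc 0 T, X), ∀ t : Icc 0 T,
      w t = U t + J (duhamel S (fun s => N (w (projIcc 0 T hT s))) t) := by
  have hcont : ∀ w : C(Icc 0 T, X), Continuous fun s => N (w (projIcc 0 T hT s)) := fun w =>
    hN.continuous.comp (w.continuous.comp continuous_projIcc)
  obtain ⟨β, hβ⟩ := hS.exists_weight
    (show (0 : ℝ) < (2 * (‖J‖ * L + 1))⁻¹ by positivity)
  -- Conjugating by `e^{βt}` turns the weighted norm into the supremum norm.
  let m : ℝ → C(Icc 0 T, X) → C(Icc 0 T, X) := fun b w =>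
    ⟨fun t => Real.exp (b * t) • w t, by fun_prop⟩
  have hm : ∀ b w, m b (m (-b) w) = w := by
    intro b w
    ext t
    simp [m, smul_smul, ← Real.exp_add]
  let Φ : C(Icc 0 T, X) → C(Icc 0 T, X) := fun w =>
    ⟨fun t => U t + J (duhamel S (fun s => N (w (projIcc 0 T hT s))) t),
      U.continuous.add (J.continuous.comp
        (continuousOn_iff_continuous_domRestrict.1 (hS.continuousOn_duhamel (hcont w))))⟩
  let Ψ : C(Icc 0 T, X) → C(Icc 0 T, X) := fun w => m (-β) (Φ (m β w))
  have hΨ : ContractingWith (1 / 2 : ℝ≥0) Ψ := by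
    refine ⟨by norm_num, LipschitzWith.of_dist_le_mul fun v w => ?_⟩
    rw [dist_eq_norm, dist_eq_norm]
    have hL : ∀ s ∈ Icc 0 T, ‖N (m β v (projIcc 0 T hT s)) - N (m β w (projIcc 0 T hT s))‖ ≤
        (L * ‖v - w‖) * Real.exp (β * s) := by
      intro s hs
      refine (hN.norm_sub_le _ _).trans ?_
      rw [projIcc_of_mem hT hs]
      have h1 : m β v ⟨s, hs⟩ - m β w ⟨s, hs⟩ = Real.exp (β * s) • (v - w) ⟨s, hs⟩ := by
        simp [m, smul_sub]
      rw [h1, norm_smul, Real.norm_of_nonneg (Real.exp_pos _).le, mul_assoc]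
      have := (v - w).norm_coe_le_norm ⟨s, hs⟩
      nlinarith [mul_le_mul_of_nonneg_left this (mul_nonneg L.coe_nonneg (Real.exp_pos (β * s)).le)]
    rw [ContinuousMap.norm_le _ (by positivity)]
    intro t
    have key := hS.norm_duhamel_sub_le (hcont (m β v)) (hcont (m β w)) hL t.2
    have h2 : (Ψ v - Ψ w) t = Real.exp (-β * t) •
        J (duhamel S (fun s => N (m β v (projIcc 0 T hT s))) t -
          duhamel S (fun s => N (m β w (projIcc 0 T hT s))) t) := by
      simp only [Ψ, Φ, m, ContinuousMap.sub_apply, ContinuousMap.coe_mk, map_sub, ← smul_sub]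
      rw [add_sub_add_left_eq_sub]
    rw [h2, norm_smul, Real.norm_of_nonneg (Real.exp_pos _).le]
    set I := ∫ r in Ioc 0 T, K r * Real.exp (-β * r)
    have hI : ‖J‖ * L * I ≤ 1 / 2 := by
      have h3 : 0 ≤ ‖J‖ * (L : ℝ) := by positivity
      calc ‖J‖ * L * I ≤ ‖J‖ * L * (2 * (‖J‖ * L + 1))⁻¹ := by gcongr
        _ ≤ 1 / 2 := by
          rw [← div_eq_mul_inv, div_le_div_iff₀ (by positivity) (by norm_num)]
          linarith
    calc _ ≤ Real.exp (-β * t) * (‖J‖ * (L * ‖v - w‖ * Real.exp (β * t) * I)) := by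
          gcongr
          exact J.le_opNorm_of_le key
      _ = (Real.exp (-β * t) * Real.exp (β * t)) * (‖J‖ * L * I) * ‖v - w‖ := by ring
      _ = (‖J‖ * L * I) * ‖v - w‖ := by rw [← Real.exp_add]; simp
      _ ≤ _ := by
          have : ((1 / 2 : ℝ≥0) : ℝ) = 1 / 2 := by norm_num
          rw [this]
          gcongr
  have hiff : ∀ w : C(Icc 0 T, X), (∀ t : Icc 0 T,
      w t = U t + J (duhamel S (fun s => N (w (projIcc 0 T hT s))) t)) ↔ Φ w = w := fun w =>
    ⟨fun h => ContinuousMap.ext fun t => (h t).symm, fun h t => (DFunLike.congr_fun h t).symm⟩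
  simp only [hiff]
  refine ⟨m β (ContractingWith.fixedPoint Ψ hΨ), ?_, fun w hw => ?_⟩
  · have := hΨ.fixedPoint_isFixedPt (f := Ψ)
    have h4 := congrArg (m β) this
    simpa only [Ψ, hm] using h4
  · have hfix : Function.IsFixedPt Ψ (m (-β) w) := by
      change m (-β) (Φ (m β (m (-β) w))) = _
      rw [hm, hw]
    rw [← hΨ.fixedPoint_unique hfix, hm]

end IsSmoothingFamily

end Volterra

open UnitAddTorus (mFourier)

/-! ### Fourier coefficients on the torus -/

/-- Complex-valued `L²` functions on the torus. -/
abbrev L2Torus : Type := Lp ℂ 2 (volume : Measure Torus2)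

/-- The inclusion of continuous functions into `L²(𝕋²)`. -/
noncomputable abbrev toL2 : C(Torus2, ℂ) →L[ℂ] L2Torus := ContinuousMap.toLp (E := ℂ) 2 volume ℂ

/-- The exponentials form a Hilbert basis of `L²(𝕋²)`; the measure on the circle used in Mathlib's
Fourier theory is the normalised Haar measure, which is equal to `volume`. -/
theorem exists_fourierBasis : ∃ b : HilbertBasis (Fin 2 → ℤ) ℂ L2Torus,
    ⇑b = fun n => toL2 (mFourier n) := by
  have h : (volume : Measure UnitAddCircle) = AddCircle.haarAddCircle := by
    rw [AddCircle.volume_eq_smul_haarAddCircle]; simp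
  have key : ∀ (μ : Measure UnitAddCircle) [IsFiniteMeasure μ], AddCircle.haarAddCircle = μ →
      ∃ b : HilbertBasis (Fin 2 → ℤ) ℂ (Lp ℂ 2 (Measure.pi fun _ : Fin 2 => μ)),
        ⇑b = fun n =>
          ContinuousMap.toLp (E := ℂ) 2 (Measure.pi fun _ : Fin 2 => μ) ℂ (mFourier n) := by
    rintro μ _ rfl
    exact ⟨UnitAddTorus.mFourierBasis, UnitAddTorus.coe_mFourierBasis⟩
  exact key volume h.symm

/-- The `n`-th Fourier coefficient as a continuous linear functional on `L²(𝕋²)`. -/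
noncomputable def fourierCLM (n : Fin 2 → ℤ) : L2Torus →L[ℂ] ℂ := innerSL ℂ (toL2 (mFourier n))

lemma fourierCLM_apply (n : Fin 2 → ℤ) (f : L2Torus) :
    fourierCLM n f = inner ℂ (toL2 (mFourier n)) f := rfl

theorem orthonormal_exponentials : Orthonormal ℂ fun n : Fin 2 → ℤ => toL2 (mFourier n) := by
  obtain ⟨b, hb⟩ := exists_fourierBasis
  exact hb ▸ b.orthonormal

theorem ext_fourierCLM {f g : L2Torus} (h : ∀ n, fourierCLM n f = fourierCLM n g) : f = g := by
  obtain ⟨b, hb⟩ := exists_fourierBasis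
  apply b.repr.injective
  ext n
  rw [b.repr_apply_apply, b.repr_apply_apply, hb]
  exact h n

theorem hasSum_inner_fourierCLM (f g : L2Torus) :
    HasSum (fun n => starRingEnd ℂ (fourierCLM n f) * fourierCLM n g) (inner ℂ f g) := by
  obtain ⟨b, hb⟩ := exists_fourierBasis
  simpa [hb, fourierCLM_apply] using b.hasSum_inner_mul_inner f g

lemma toL2_injective : Function.Injective toL2 := ContinuousMap.toLp_injective volume

/-! ### Frequencies, eigenvalues and weights -/

/-- The eigenvalue of `-Δ` on the exponential of frequency `n`. -/
noncomputable def eigenvalue (n : Fin 2 → ℤ) : ℝ := ∑ i, (2 * Real.pi * n i) ^ 2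

/-- The Japanese bracket `1 + |n|` of a frequency, with `|n|` the maximum norm on `ℤ²`. -/
noncomputable def bracket (n : Fin 2 → ℤ) : ℝ := 1 + ‖n‖

lemma one_le_bracket (n : Fin 2 → ℤ) : 1 ≤ bracket n := by
  simp [bracket]

lemma bracket_pos (n : Fin 2 → ℤ) : 0 < bracket n := one_pos.trans_le (one_le_bracket n)

lemma eigenvalue_nonneg (n : Fin 2 → ℤ) : 0 ≤ eigenvalue n :=
  Finset.sum_nonneg fun _ _ => sq_nonneg _

lemma bracket_sq_le (n : Fin 2 → ℤ) : bracket n ^ 2 ≤ eigenvalue n + 1 := by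
  have h1 : ‖n‖ ^ 2 * 4 ≤ eigenvalue n := by
    have hi : ∀ i, (n i : ℝ) ^ 2 * 4 ≤ eigenvalue n := by
      intro i
      refine le_trans ?_ (Finset.single_le_sum (f := fun i => (2 * Real.pi * n i) ^ 2)
        (fun _ _ => sq_nonneg _) (Finset.mem_univ i))
      have h3 := Real.pi_gt_three
      have : (1 : ℝ) ≤ Real.pi ^ 2 := by nlinarith
      nlinarith [sq_nonneg (n i : ℝ)]
    have hn : ‖n‖ ≤ Real.sqrt (eigenvalue n / 4) := by
      rw [pi_norm_le_iff_of_nonneg (Real.sqrt_nonneg _)]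
      intro i
      refine Real.le_sqrt_of_sq_le ?_
      rw [Int.norm_eq_abs, sq_abs]
      linarith [hi i]
    have := pow_le_pow_left₀ (norm_nonneg n) hn 2
    rw [Real.sq_sqrt (by linarith [eigenvalue_nonneg n])] at this
    linarith
  rcases eq_or_ne n 0 with rfl | hn
  · simp [bracket, eigenvalue]
  · have h2 : 1 ≤ ‖n‖ := by
      obtain ⟨i, hi⟩ := Function.ne_iff.1 hn
      refine le_trans ?_ (norm_le_pi_norm n i)
      rw [Int.norm_eq_abs]
      exact_mod_cast Int.one_le_abs hi
    rw [bracket]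
    nlinarith

lemma summable_bracket_rpow {k : ℝ} (hk : 2 < k) : Summable fun n => bracket n ^ (-k) := by
  refine ((EisensteinSeries.summable_one_div_norm_rpow hk).add
    (hasSum_ite_eq (0 : Fin 2 → ℤ) (1 : ℝ)).summable).of_nonneg_of_le
    (fun n => (Real.rpow_pos_of_pos (bracket_pos n) _).le) fun n => ?_
  by_cases hn : n = 0
  · subst hn
    have : (0 : ℝ) ^ (-k) = 0 := Real.zero_rpow (by linarith)
    simp [bracket, this]
  · rw [if_neg hn, add_zero]
    exact Real.rpow_le_rpow_of_nonpos (norm_pos_iff.2 hn) (by simp [bracket]) (by linarith)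

/-- `e^{-x} ≤ x^{-b}` for `0 ≤ b ≤ 1`. -/
lemma exp_neg_le_rpow_neg {x b : ℝ} (hx : 0 < x) (hb0 : 0 ≤ b) (hb1 : b ≤ 1) :
    Real.exp (-x) ≤ x ^ (-b) := by
  rw [Real.exp_neg, Real.rpow_neg hx.le]
  refine inv_anti₀ (Real.rpow_pos_of_pos hx b) ?_
  calc x ^ b ≤ (Real.exp x) ^ b := by
        refine Real.rpow_le_rpow hx.le ?_ hb0
        linarith [Real.add_one_le_exp x]
    _ ≤ (Real.exp x) ^ (1 : ℝ) :=
        Real.rpow_le_rpow_of_exponent_le (Real.one_le_exp hx.le) hb1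
    _ = _ := Real.rpow_one _

/-- Parabolic smoothing of one Fourier mode, with the exponent `(3 + η) / 4 < 1` of the time
singularity chosen such that the remaining weight `bracket n ^ ((η - 3) / 2)` is square summable. -/
lemma weight_mul_exp_le {η : ℝ} (hη0 : 0 < η) (hη1 : η < 1) {r : ℝ} (hr : 0 < r)
    (n : Fin 2 → ℤ) : bracket n ^ η * Real.exp (-eigenvalue n * r) ≤
      Real.exp r * r ^ (-((3 + η) / 4)) * bracket n ^ ((η - 3) / 2) := by
  have hq := bracket_pos n
  have h1 : Real.exp (-eigenvalue n * r) ≤ Real.exp r * Real.exp (-(bracket n ^ 2 * r)) := by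
    rw [← Real.exp_add]
    refine Real.exp_le_exp.2 ?_
    nlinarith [bracket_sq_le n]
  have h2 := exp_neg_le_rpow_neg (x := bracket n ^ 2 * r) (b := (3 + η) / 4) (by positivity)
    (by linarith) (by linarith)
  rw [Real.mul_rpow (by positivity) hr.le, ← Real.rpow_natCast, ← Real.rpow_mul hq.le] at h2
  calc bracket n ^ η * Real.exp (-eigenvalue n * r)
      ≤ bracket n ^ η * (Real.exp r * (bracket n ^ (((2 : ℕ) : ℝ) * -((3 + η) / 4)) *
          r ^ (-((3 + η) / 4)))) := by
        refine mul_le_mul_of_nonneg_left (h1.trans ?_) (by positivity)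
        exact mul_le_mul_of_nonneg_left (by simpa using h2) (Real.exp_pos _).le
    _ = Real.exp r * r ^ (-((3 + η) / 4)) *
          (bracket n ^ η * bracket n ^ (((2 : ℕ) : ℝ) * -((3 + η) / 4))) := by ring
    _ = _ := by
        rw [← Real.rpow_add hq]
        congr 2
        push_cast
        ring

/-! ### The heat semigroup from `L²` to a weighted Wiener algebra -/

/-- Absolutely summable sequences on `ℤ²`. The sequence `a` represents the function with Fourier
coefficients `bracket n ^ (-η) * a n`, so that `lp` becomes a weighted Wiener algebra. -/
abbrev WienerSeq : Type := lp (fun _ : Fin 2 → ℤ => ℂ) 1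

lemma memℓp_one_iff {a : (Fin 2 → ℤ) → ℂ} : Memℓp a 1 ↔ Summable fun n => ‖a n‖ := by
  rw [memℓp_gen_iff (by simp)]
  simp

lemma wienerSeq_norm_eq (a : WienerSeq) : ‖a‖ = ∑' n, ‖a n‖ := by
  rw [lp.norm_eq_tsum_rpow (by simp)]
  simp

lemma wienerSeq_summable (a : WienerSeq) : Summable fun n => ‖a n‖ := memℓp_one_iff.1 a.2

/-- The constant in the smoothing estimate `L² → WienerSeq`. -/
noncomputable def smoothingConst (η : ℝ) : ℝ := Real.sqrt (∑' n, bracket n ^ (-(3 - η)))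

/-- Cauchy-Schwarz against the square summable weight. -/
lemma summable_and_tsum_bracket_mul_fourierCLM {η : ℝ} (hη1 : η < 1) (f : L2Torus) :
    Summable (fun n => bracket n ^ ((η - 3) / 2) * ‖fourierCLM n f‖) ∧
    ∑' n, bracket n ^ ((η - 3) / 2) * ‖fourierCLM n f‖ ≤ smoothingConst η * ‖f‖ := by
  have hsq : ∀ n, (bracket n ^ ((η - 3) / 2)) ^ (2 : ℝ) = bracket n ^ (-(3 - η)) := by
    intro n
    rw [← Real.rpow_mul (bracket_pos n).le]
    congr 1
    ring
  have h0 : ∀ n, 0 ≤ bracket n ^ ((η - 3) / 2) := fun n =>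
    (Real.rpow_pos_of_pos (bracket_pos n) _).le
  have h1 : Summable fun n => (bracket n ^ ((η - 3) / 2)) ^ (2 : ℝ) := by
    simp only [hsq]
    exact summable_bracket_rpow (by linarith)
  have h2 : Summable fun n => ‖fourierCLM n f‖ ^ (2 : ℝ) := by
    simp only [Real.rpow_two]
    exact orthonormal_exponentials.inner_products_summable f
  have h3 : ∑' n, ‖fourierCLM n f‖ ^ (2 : ℝ) ≤ ‖f‖ ^ 2 := by
    simp only [Real.rpow_two]
    exact orthonormal_exponentials.tsum_inner_products_le f
  have hpq : Real.HolderConjugate 2 2 := by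
    rw [Real.holderConjugate_iff]; norm_num
  refine ⟨Real.summable_mul_of_Lp_Lq_of_nonneg hpq h0 (fun _ => norm_nonneg _) h1 h2, ?_⟩
  refine (Real.inner_le_Lp_mul_Lq_tsum_of_nonneg hpq h0 (fun _ => norm_nonneg _) h1 h2).trans ?_
  simp only [hsq, ← Real.sqrt_eq_rpow]
  refine mul_le_mul_of_nonneg_left ?_ (Real.sqrt_nonneg _)
  rw [← Real.sqrt_sq (norm_nonneg f)]
  exact Real.sqrt_le_sqrt h3

/-- The weighted Fourier coefficients of `e^{rΔ} f`. -/
noncomputable def heatSeq (η r : ℝ) (f : L2Torus) (n : Fin 2 → ℤ) : ℂ :=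
  ((bracket n ^ η * Real.exp (-eigenvalue n * r) : ℝ) : ℂ) * fourierCLM n f

lemma summable_heatSeq_and_tsum_le {η : ℝ} (hη0 : 0 < η) (hη1 : η < 1) {r : ℝ} (hr : 0 < r)
    (f : L2Torus) : Summable (fun n => ‖heatSeq η r f n‖) ∧ ∑' n, ‖heatSeq η r f n‖ ≤
      Real.exp r * r ^ (-((3 + η) / 4)) * smoothingConst η * ‖f‖ := by
  obtain ⟨hs, hle⟩ := summable_and_tsum_bracket_mul_fourierCLM hη1 f
  have hb : ∀ n, ‖heatSeq η r f n‖ ≤ Real.exp r * r ^ (-((3 + η) / 4)) *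
      (bracket n ^ ((η - 3) / 2) * ‖fourierCLM n f‖) := by
    intro n
    have h0 := Real.rpow_pos_of_pos (bracket_pos n) η
    rw [heatSeq, norm_mul, Complex.norm_real, Real.norm_of_nonneg (by positivity), ← mul_assoc]
    exact mul_le_mul_of_nonneg_right (weight_mul_exp_le hη0 hη1 hr n) (norm_nonneg _)
  have hs' := (hs.mul_left (Real.exp r * r ^ (-((3 + η) / 4)))).of_nonneg_of_le
    (fun _ => norm_nonneg _) hb
  refine ⟨hs', (hs'.tsum_le_tsum hb (hs.mul_left _)).trans ?_⟩
  rw [tsum_mul_left, mul_assoc _ (smoothingConst η)]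
  exact mul_le_mul_of_nonneg_left hle (by positivity)

open Classical in
/-- The heat semigroup `e^{rΔ} : L² → WienerSeq` at a time `r > 0`; it is set to zero for
`r ≤ 0`. -/
noncomputable def heatOp (η : ℝ) (hη0 : 0 < η) (hη1 : η < 1) (r : ℝ) : L2Torus →L[ℝ] WienerSeq :=
  if hr : 0 < r then
    LinearMap.mkContinuous
      { toFun := fun f => ⟨heatSeq η r f,
          memℓp_one_iff.2 (summable_heatSeq_and_tsum_le hη0 hη1 hr f).1⟩
        map_add' := fun f g => by
          ext n
          change heatSeq η r (f + g) n = heatSeq η r f n + heatSeq η r g n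
          simp only [heatSeq, map_add, mul_add]
        map_smul' := fun c f => by
          ext n
          have : fourierCLM n (c • f) = (c : ℂ) * fourierCLM n f := by
            rw [← smul_eq_mul, ← map_smul]
            rfl
          simp only [heatSeq, this, lp.coeFn_smul, Pi.smul_apply, Complex.real_smul,
            RingHom.id_apply]
          ring }
      (Real.exp r * r ^ (-((3 + η) / 4)) * smoothingConst η)
      fun f => (wienerSeq_norm_eq _).trans_le (summable_heatSeq_and_tsum_le hη0 hη1 hr f).2
  else 0

lemma heatOp_apply {η : ℝ} (hη0 : 0 < η) (hη1 : η < 1) {r : ℝ} (hr : 0 < r) (f : L2Torus)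
    (n : Fin 2 → ℤ) : heatOp η hη0 hη1 r f n =
      ((bracket n ^ η * Real.exp (-eigenvalue n * r) : ℝ) : ℂ) * fourierCLM n f := by
  rw [heatOp, dif_pos hr]
  rfl

theorem isSmoothingFamily_heatOp {η : ℝ} (hη0 : 0 < η) (hη1 : η < 1) (T : ℝ) :
    IsSmoothingFamily T (heatOp η hη0 hη1)
      (fun r => Real.exp r * r ^ (-((3 + η) / 4)) * smoothingConst η) := by
  refine ⟨?_, fun r hr => ?_, fun G hG => ?_⟩
  · have h1 : IntegrableOn (fun r : ℝ => r ^ (-((3 + η) / 4))) (Ioc 0 T) := by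
      rcases le_or_gt 0 T with hT | hT
      · exact (intervalIntegrable_iff_integrableOn_Ioc_of_le hT).1
          (intervalIntegral.intervalIntegrable_rpow' (by linarith))
      · simp [Ioc_eq_empty_of_le hT.le]
    refine (Integrable.bdd_mul (c := Real.exp T) h1
      Real.continuous_exp.aestronglyMeasurable ?_).mul_const _
    filter_upwards [ae_restrict_mem measurableSet_Ioc] with r hr
    rw [Real.norm_of_nonneg (Real.exp_pos _).le]
    exact Real.exp_le_exp.2 hr.2
  · rw [heatOp, dif_pos hr.1]
    refine LinearMap.mkContinuous_norm_le _ ?_ _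
    have : 0 < r := hr.1
    have : 0 ≤ smoothingConst η := Real.sqrt_nonneg _
    positivity
  · -- The sequence is the limit of its finite truncations, which depend continuously on `r`.
    refine aestronglyMeasurable_of_tendsto_ae (u := (atTop : Filter (Finset (Fin 2 → ℤ))))
      (f := fun s r => ∑ n ∈ s, lp.single (E := fun _ : Fin 2 → ℤ => ℂ) 1 n
        (((bracket n ^ η * Real.exp (-eigenvalue n * r) : ℝ) : ℂ) * fourierCLM n (G r))) ?_ ?_
    · intro s
      refine Continuous.aestronglyMeasurable (continuous_finsetSum _ fun n _ => ?_)
      have h1 : Continuous fun c : ℂ => lp.single (E := fun _ : Fin 2 → ℤ => ℂ) 1 n c :=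
        (lp.singleContinuousLinearMap ℂ (fun _ : Fin 2 → ℤ => ℂ) 1 n).continuous
      exact h1.comp (by fun_prop)
    · filter_upwards [ae_restrict_mem measurableSet_Ioc] with r hr
      have := lp.hasSum_single (E := fun _ : Fin 2 → ℤ => ℂ) ENNReal.one_ne_top
        (heatOp η hη0 hη1 r (G r))
      rw [HasSum, SummationFilter.unconditional_filter] at this
      simpa only [heatOp_apply hη0 hη1 hr.1] using this

/-! ### Synthesis of a function from its weighted Fourier coefficients -/

/-- The Fourier coefficient of the function represented by `a`. -/
noncomputable def unweight (η : ℝ) (a : WienerSeq) (n : Fin 2 → ℤ) : ℂ :=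
  ((bracket n ^ (-η) : ℝ) : ℂ) * a n

lemma norm_unweight (η : ℝ) (a : WienerSeq) (n : Fin 2 → ℤ) :
    ‖unweight η a n‖ = bracket n ^ (-η) * ‖a n‖ := by
  have := Real.rpow_pos_of_pos (bracket_pos n) (-η)
  rw [unweight, norm_mul, Complex.norm_real, Real.norm_of_nonneg this.le]

lemma norm_unweight_le {η : ℝ} (hη0 : 0 < η) (a : WienerSeq) (n : Fin 2 → ℤ) :
    ‖unweight η a n‖ ≤ ‖a n‖ := by
  rw [norm_unweight]
  refine mul_le_of_le_one_left (norm_nonneg _) ?_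
  exact Real.rpow_le_one_of_one_le_of_nonpos (one_le_bracket n) (by linarith)

lemma norm_unweight_smul_le {η : ℝ} (hη0 : 0 < η) (a : WienerSeq) (n : Fin 2 → ℤ) :
    ‖unweight η a n • mFourier n‖ ≤ ‖a n‖ := by
  rw [norm_smul, UnitAddTorus.mFourier_norm, mul_one]
  exact norm_unweight_le hη0 a n

lemma summable_unweight_smul {η : ℝ} (hη0 : 0 < η) (a : WienerSeq) :
    Summable fun n => unweight η a n • (mFourier n : C(Torus2, ℂ)) :=
  (wienerSeq_summable a).of_norm_bounded (norm_unweight_smul_le hη0 a)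

/-- The continuous function `∑ₙ bracket n ^ (-η) * a n * eₙ` represented by `a`. -/
noncomputable def synth (η : ℝ) (hη0 : 0 < η) : WienerSeq →L[ℝ] C(Torus2, ℂ) :=
  LinearMap.mkContinuous
    { toFun := fun a => ∑' n, unweight η a n • (mFourier n : C(Torus2, ℂ))
      map_add' := fun a b => by
        rw [← (summable_unweight_smul hη0 a).tsum_add (summable_unweight_smul hη0 b)]
        congr 1
        ext n
        simp [unweight, mul_add, add_mul]
      map_smul' := fun c a => by
        rw [RingHom.id_apply, ← (summable_unweight_smul hη0 a).tsum_const_smul]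
        congr 1
        ext1 n
        rw [← smul_assoc]
        congr 1
        simp only [unweight, lp.coeFn_smul, Pi.smul_apply, Complex.real_smul]
        ring }
    1 fun a => by
      rw [one_mul, wienerSeq_norm_eq]
      exact tsum_of_norm_bounded (wienerSeq_summable a).hasSum (norm_unweight_smul_le hη0 a)

lemma hasSum_synth {η : ℝ} (hη0 : 0 < η) (a : WienerSeq) :
    HasSum (fun n => unweight η a n • (mFourier n : C(Torus2, ℂ))) (synth η hη0 a) :=
  (summable_unweight_smul hη0 a).hasSum

lemma fourierCLM_synth {η : ℝ} (hη0 : 0 < η) (a : WienerSeq) (n : Fin 2 → ℤ) :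
    fourierCLM n (toL2 (synth η hη0 a)) = unweight η a n := by
  have h := (hasSum_synth hη0 a).mapL ((fourierCLM n).comp toL2)
  refine h.unique ?_
  have h2 := hasSum_ite_eq n (unweight η a n)
  convert h2 using 2 with m
  simp only [ContinuousLinearMap.comp_apply, map_smul, fourierCLM_apply,
    orthonormal_iff_ite.1 orthonormal_exponentials n m, eq_comm (a := n)]
  split_ifs with hm <;> simp [hm]

/-! ### Coordinates on the torus and Hölder bounds for exponentials -/

lemma toTorus_add (y z : Fin 2 → ℝ) : toTorus (y + z) = toTorus y + toTorus z := by
  ext i; simp [toTorus]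

lemma toTorus_zero : toTorus 0 = 0 := by
  ext i; simp [toTorus]

lemma toTorus_neg (y : Fin 2 → ℝ) : toTorus (-y) = -toTorus y := by
  ext i; simp [toTorus]

@[fun_prop]
lemma continuous_toTorus : Continuous toTorus :=
  continuous_pi fun i => (AddCircle.continuous_mk' 1).comp (continuous_apply i)

/-- Every point of the torus has a representative of the same norm. -/
lemma exists_toTorus_eq (z : Torus2) : ∃ y, toTorus y = z ∧ ‖y‖ = ‖z‖ := by
  have h : ∀ c : UnitAddCircle, ∃ s : ℝ, (s : UnitAddCircle) = c ∧ ‖s‖ = ‖c‖ := by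
    intro c
    induction c using QuotientAddGroup.induction_on with
    | H s =>
      refine ⟨s - round s, ?_, ?_⟩
      · rw [AddCircle.coe_sub, sub_eq_self, AddCircle.coe_eq_zero_iff]
        exact ⟨round s, by simp⟩
      · rw [UnitAddCircle.norm_eq, Real.norm_eq_abs]
  choose y hy1 hy2 using fun i => h (z i)
  refine ⟨y, funext hy1, ?_⟩
  simp only [Pi.norm_def, ← norm_toNNReal, hy2]

lemma norm_toTorus_le (y : Fin 2 → ℝ) : ‖toTorus y‖ ≤ ‖y‖ := by
  rw [pi_norm_le_iff_of_nonneg (norm_nonneg y)]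
  intro i
  refine le_trans ?_ (norm_le_pi_norm y i)
  rw [toTorus, UnitAddCircle.norm_eq, Real.norm_eq_abs]
  simpa using round_le (y i) 0

/-- The phase of the exponential of frequency `n`. -/
noncomputable def phase (n : Fin 2 → ℤ) (y : Fin 2 → ℝ) : ℝ := ∑ i, 2 * Real.pi * n i * y i

lemma mFourier_toTorus (n : Fin 2 → ℤ) (y : Fin 2 → ℝ) :
    mFourier n (toTorus y) = Complex.exp (Complex.I * phase n y) := by
  simp only [mFourier, ContinuousMap.coe_mk, toTorus, fourier_coe_apply, phase, ← Complex.exp_sum]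
  congr 1
  push_cast
  rw [Finset.mul_sum]
  refine Finset.sum_congr rfl fun i _ => ?_
  simp
  ring

lemma mFourier_add_apply (n : Fin 2 → ℤ) (x y : Torus2) :
    mFourier n (x + y) = mFourier n x * mFourier n y := by
  simp only [mFourier, ContinuousMap.coe_mk, Pi.add_apply, fourier_apply, smul_add,
    AddCircle.toCircle_add, Circle.coe_mul, Finset.prod_mul_distrib]

lemma norm_mFourier_apply (n : Fin 2 → ℤ) (x : Torus2) : ‖mFourier n x‖ = 1 := by
  obtain ⟨y, rfl, -⟩ := exists_toTorus_eq x
  rw [mFourier_toTorus, mul_comm, Complex.norm_exp_ofReal_mul_I]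

lemma norm_mFourier_sub_le (n : Fin 2 → ℤ) (x y : Torus2) :
    ‖mFourier n x - mFourier n y‖ ≤ 4 * Real.pi * bracket n * dist x y := by
  obtain ⟨z, hz, hz'⟩ := exists_toTorus_eq (x - y)
  have hx : x = y + toTorus z := by rw [hz]; abel
  rw [dist_eq_norm, ← hz']
  rw [hx, mFourier_add_apply, ← mul_sub_one, norm_mul, norm_mFourier_apply, one_mul,
    mFourier_toTorus]
  refine (Real.norm_exp_I_mul_ofReal_sub_one_le).trans ?_
  rw [phase]
  have hb : ∀ i, ‖2 * Real.pi * n i * z i‖ ≤ 2 * Real.pi * bracket n * ‖z‖ := by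
    intro i
    have h1 : ‖(n i : ℝ)‖ ≤ bracket n := by
      have := norm_le_pi_norm n i
      rw [Int.norm_eq_abs] at this
      rw [Real.norm_eq_abs, bracket]
      linarith
    have h2 := norm_le_pi_norm z i
    rw [norm_mul, norm_mul, Real.norm_of_nonneg (by positivity : 0 ≤ 2 * Real.pi)]
    gcongr
    have := bracket_pos n
    positivity
  refine (norm_sum_le_of_le _ fun i _ => hb i).trans (le_of_eq ?_)
  simp
  ring

/-- Interpolation between two upper bounds. -/
lemma le_rpow_mul_rpow {a A B θ : ℝ} (ha : 0 ≤ a) (hA : a ≤ A) (hB : a ≤ B) (h0 : 0 ≤ θ)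
    (h1 : θ ≤ 1) : a ≤ A ^ (1 - θ) * B ^ θ := by
  rcases ha.eq_or_lt with rfl | ha'
  · exact mul_nonneg (Real.rpow_nonneg hA _) (Real.rpow_nonneg hB _)
  · calc a = a ^ (1 - θ) * a ^ θ := by rw [← Real.rpow_add ha']; simp
      _ ≤ _ := mul_le_mul (Real.rpow_le_rpow ha hA (by linarith)) (Real.rpow_le_rpow ha hB h0)
        (Real.rpow_nonneg ha _) (Real.rpow_nonneg (ha.trans hA) _)

lemma norm_mFourier_sub_le_rpow {η : ℝ} (hη0 : 0 < η) (hη1 : η < 1) (n : Fin 2 → ℤ)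
    (x y : Torus2) :
    ‖mFourier n x - mFourier n y‖ ≤ 4 * Real.pi * bracket n ^ η * dist x y ^ η := by
  have h1 : ‖mFourier n x - mFourier n y‖ ≤ 4 * Real.pi := by
    refine (norm_sub_le _ _).trans ?_
    rw [norm_mFourier_apply, norm_mFourier_apply]
    linarith [Real.pi_gt_three]
  refine (le_rpow_mul_rpow (norm_nonneg _) h1 (norm_mFourier_sub_le n x y) hη0.le
    hη1.le).trans (le_of_eq ?_)
  have hpi : 0 < 4 * Real.pi := by positivity
  have hb := (bracket_pos n).le
  rw [Real.mul_rpow (by positivity) dist_nonneg, Real.mul_rpow hpi.le hb, ← mul_assoc, ← mul_assoc,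
    ← Real.rpow_add hpi]
  simp

/-! ### The Hölder norm -/

lemma holderNorm_le {η : ℝ≥0} {f : Torus2 → ℝ} {A B : ℝ} (hA : 0 ≤ A) (hB : 0 ≤ B)
    (h1 : ∀ x, |f x| ≤ A) (h2 : ∀ x y, |f x - f y| ≤ B * dist x y ^ (η : ℝ)) :
    holderNorm η f ≤ ENNReal.ofReal (A + B) := by
  rw [ENNReal.ofReal_add hA hB, holderNorm]
  gcongr
  · refine iSup_le fun x => ?_
    rw [← ofReal_norm]
    exact ENNReal.ofReal_le_ofReal (h1 x)
  · refine HolderWith.eHolderNorm_le (C := B.toNNReal) fun x y => ?_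
    rw [edist_dist, edist_dist, Real.dist_eq, ENNReal.ofReal_rpow_of_nonneg dist_nonneg η.coe_nonneg]
    change _ ≤ ENNReal.ofReal B * _
    rw [← ENNReal.ofReal_mul hB]
    exact ENNReal.ofReal_le_ofReal (h2 x y)

lemma holderNorm_add_le (η : ℝ≥0) (f g : Torus2 → ℝ) :
    holderNorm η (f + g) ≤ holderNorm η f + holderNorm η g := by
  rw [holderNorm, holderNorm, holderNorm, add_add_add_comm]
  gcongr
  · exact iSup_le fun x => (enorm_add_le _ _).trans
      (add_le_add (le_iSup (fun x => ‖f x‖ₑ) x) (le_iSup (fun x => ‖g x‖ₑ) x))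
  · exact eHolderNorm_add_le

lemma enorm_apply_le_holderNorm (η : ℝ≥0) (f : Torus2 → ℝ) (x : Torus2) :
    ‖f x‖ₑ ≤ holderNorm η f :=
  (le_iSup (fun x => ‖f x‖ₑ) x).trans le_self_add

lemma IsSmooth.add {φ ψ : Torus2 → ℝ} (hφ : IsSmooth φ) (hψ : IsSmooth ψ) : IsSmooth (φ + ψ) :=
  ContDiff.add hφ hψ

lemma isSmooth_finset_sum {ι : Type*} {s : Finset ι} {φ : ι → Torus2 → ℝ}
    (h : ∀ i ∈ s, IsSmooth (φ i)) : IsSmooth fun x => ∑ i ∈ s, φ i x :=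
  ContDiff.sum h

lemma isSmooth_re_mFourier (n : Fin 2 → ℤ) (c : ℂ) :
    IsSmooth fun x => (c * mFourier n x).re := by
  simp only [IsSmooth, mFourier_toTorus, phase]
  have h1 : ContDiff ℝ ∞ fun y : Fin 2 → ℝ => (∑ i, 2 * Real.pi * n i * y i : ℝ) := by fun_prop
  have h2 : ContDiff ℝ ∞ fun y : Fin 2 → ℝ =>
      c * Complex.exp (Complex.I * ((∑ i, 2 * Real.pi * n i * y i : ℝ) : ℂ)) :=
    contDiff_const.mul ((contDiff_const.mul (Complex.ofRealCLM.contDiff.comp h1)).cexp)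
  exact Complex.reCLM.contDiff.comp h2

lemma HolderSpace.add {η : ℝ≥0} {f g : Torus2 → ℝ} (hf : f ∈ HolderSpace η)
    (hg : g ∈ HolderSpace η) : f + g ∈ HolderSpace η := by
  intro ε hε
  obtain ⟨φ, hφ, h1⟩ := hf (ε / 2) (ENNReal.half_pos hε.ne')
  obtain ⟨ψ, hψ, h2⟩ := hg (ε / 2) (ENNReal.half_pos hε.ne')
  refine ⟨φ + ψ, hφ.add hψ, ?_⟩
  rw [add_sub_add_comm]
  refine (holderNorm_add_le _ _ _).trans_lt ?_
  rw [← ENNReal.add_halves ε]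
  exact ENNReal.add_lt_add h1 h2

/-- Pointwise real part of a continuous function. -/
noncomputable def reFun (f : C(Torus2, ℂ)) (x : Torus2) : ℝ := (f x).re

/-- The synthesis operator maps into Hölder functions: this is the reason for the weight. -/
lemma holderNorm_synth_le {η : ℝ≥0} (hη0 : 0 < (η : ℝ)) (hη1 : (η : ℝ) < 1) (a : WienerSeq) :
    holderNorm η (reFun (synth η hη0 a)) ≤ ENNReal.ofReal ((1 + 4 * Real.pi) * ‖a‖) := by
  have hs := wienerSeq_summable a
  have hx : ∀ x, HasSum (fun n => unweight η a n * mFourier n x) (synth η hη0 a x) := fun x =>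
    (ContinuousMap.evalCLM ℂ x).hasSum (hasSum_synth hη0 a)
  rw [add_mul, one_mul]
  refine holderNorm_le (norm_nonneg a) (by positivity) (fun x => ?_) fun x y => ?_
  · refine (Complex.abs_re_le_norm _).trans ?_
    rw [wienerSeq_norm_eq, ← (hx x).tsum_eq]
    refine tsum_of_norm_bounded hs.hasSum fun n => ?_
    rw [norm_mul, norm_mFourier_apply, mul_one]
    exact norm_unweight_le hη0 a n
  · rw [reFun, reFun, ← Complex.sub_re]
    refine (Complex.abs_re_le_norm _).trans ?_
    rw [← ((hx x).sub (hx y)).tsum_eq]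
    have h3 := (hs.mul_left (4 * Real.pi * dist x y ^ (η : ℝ))).hasSum
    rw [tsum_mul_left, ← wienerSeq_norm_eq] at h3
    rw [mul_right_comm]
    refine tsum_of_norm_bounded h3 fun n => ?_
    rw [← mul_sub, norm_mul, norm_unweight]
    have hb := bracket_pos n
    calc _ ≤ bracket n ^ (-(η : ℝ)) * ‖a n‖ *
          (4 * Real.pi * bracket n ^ (η : ℝ) * dist x y ^ (η : ℝ)) := by
          gcongr
          exact norm_mFourier_sub_le_rpow hη0 hη1 n x y
      _ = (bracket n ^ (-(η : ℝ)) * bracket n ^ (η : ℝ)) *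
          (4 * Real.pi * dist x y ^ (η : ℝ) * ‖a n‖) := by ring
      _ = _ := by rw [← Real.rpow_add hb]; simp

lemma synth_single {η : ℝ} (hη0 : 0 < η) (n : Fin 2 → ℤ) (c : ℂ) :
    synth η hη0 (lp.single (E := fun _ : Fin 2 → ℤ => ℂ) 1 n c) =
      (((bracket n ^ (-η) : ℝ) : ℂ) * c) • (mFourier n : C(Torus2, ℂ)) := by
  refine (hasSum_synth hη0 _).unique ?_
  have h := hasSum_single (f := fun m => unweight η
    (lp.single (E := fun _ : Fin 2 → ℤ => ℂ) 1 n c) m • (mFourier m : C(Torus2, ℂ))) n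
    fun m hm => by
      simp only [unweight, lp.single_apply_ne _ _ _ hm, mul_zero]
      exact zero_smul ℂ (mFourier m : C(Torus2, ℂ))
  simpa [unweight] using h

/-- Functions in the weighted Wiener algebra are limits of trigonometric polynomials in the Hölder
norm. -/
lemma synth_mem_holderSpace {η : ℝ≥0} (hη0 : 0 < (η : ℝ)) (hη1 : (η : ℝ) < 1) (a : WienerSeq) :
    reFun (synth η hη0 a) ∈ HolderSpace η := by
  intro ε hε
  have h := lp.hasSum_single (E := fun _ : Fin 2 → ℤ => ℂ) ENNReal.one_ne_top a
  rw [HasSum, SummationFilter.unconditional_filter] at h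
  have h2 := ((tendsto_const_nhds (x := a)).sub h).norm.const_mul (1 + 4 * Real.pi)
  have h3 := ENNReal.tendsto_ofReal h2
  simp only [sub_self, norm_zero, mul_zero, ENNReal.ofReal_zero] at h3
  obtain ⟨s, hs⟩ := (h3.eventually (gt_mem_nhds hε)).exists
  refine ⟨fun x => ∑ n ∈ s, ((((bracket n ^ (-(η : ℝ)) : ℝ) : ℂ) * a n) * mFourier n x).re,
    isSmooth_finset_sum fun n _ => isSmooth_re_mFourier n _, lt_of_le_of_lt ?_ hs⟩
  refine le_trans (le_of_eq ?_) (holderNorm_synth_le hη0 hη1 _)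
  congr 1
  ext x
  simp only [map_sub, map_sum, synth_single, reFun, Pi.sub_apply, ContinuousMap.sub_apply,
    Complex.sub_re, ContinuousMap.sum_apply, ContinuousMap.smul_apply, smul_eq_mul, Complex.re_sum]

/-! ### Smooth functions and the Hölder space -/

lemma IsSmooth.exists_lipschitz {φ : Torus2 → ℝ} (hφ : IsSmooth φ) :
    ∃ L : ℝ≥0, LipschitzWith L φ := by
  obtain ⟨R, hR⟩ := (isCompact_univ (X := Torus2)).isBounded.exists_norm_le
  obtain ⟨L, hL⟩ := (isCompact_closedBall (0 : Fin 2 → ℝ) (2 * R)).exists_bound_of_continuousOn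
    (hφ.continuous_fderiv (by simp)).continuousOn
  have hR0 : 0 ≤ R := (norm_nonneg _).trans (hR 0 (mem_univ _))
  have hL0 : 0 ≤ L := (norm_nonneg _).trans (hL 0 (by simpa using hR0))
  lift L to ℝ≥0 using hL0
  refine ⟨L, LipschitzWith.of_dist_le_mul fun x y => ?_⟩
  -- Representatives of both points lie in one fixed ball, where the derivative of the lift is
  -- bounded.
  obtain ⟨a, rfl, ha⟩ := exists_toTorus_eq y
  obtain ⟨z, hz, hz'⟩ := exists_toTorus_eq (x - toTorus a)
  have hx : x = toTorus (a + z) := by rw [toTorus_add, hz]; abel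
  have ha' : ‖a‖ ≤ R := ha ▸ hR _ (mem_univ _)
  have hzR : ‖z‖ ≤ R := hz' ▸ hR _ (mem_univ _)
  have key := (convex_closedBall (0 : Fin 2 → ℝ) (2 * R)).norm_image_sub_le_of_norm_fderiv_le
    (𝕜 := ℝ) (f := fun y => φ (toTorus y)) (C := L) (x := a) (y := a + z)
    (fun w _ => (hφ.differentiable (by simp)) w) hL
    (by rw [mem_closedBall_zero_iff]; linarith)
    (by rw [mem_closedBall_zero_iff]; linarith [norm_add_le a z])
  rw [dist_eq_norm, dist_eq_norm, ← hz', hx]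
  simpa using key

lemma IsSmooth.continuous {φ : Torus2 → ℝ} (hφ : IsSmooth φ) : Continuous φ :=
  hφ.exists_lipschitz.choose_spec.continuous

lemma holderNorm_neg (η : ℝ≥0) (f : Torus2 → ℝ) : holderNorm η (-f) = holderNorm η f := by
  have h : eHolderNorm η (-f) = eHolderNorm η f := by
    have := eHolderNorm_smul (r := η) (f := f) (-1 : ℝ)
    simpa using this
  simp only [holderNorm, h, Pi.neg_apply, enorm_neg]

lemma holderNorm_sub_comm (η : ℝ≥0) (f g : Torus2 → ℝ) :
    holderNorm η (f - g) = holderNorm η (g - f) := by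
  rw [← neg_sub, holderNorm_neg]

lemma continuous_of_mem_holderSpace {η : ℝ≥0} (hη : 0 < η) {f : Torus2 → ℝ}
    (hf : f ∈ HolderSpace η) : Continuous f := by
  obtain ⟨φ, hφ, h⟩ := hf 1 one_pos
  have h1 : MemHolder η (f - φ) := by
    rw [← eHolderNorm_lt_top]
    exact lt_of_le_of_lt le_add_self (h.trans ENNReal.one_lt_top)
  have h2 : Continuous (f - φ) := h1.holderWith.continuous hη
  simpa using h2.add hφ.continuous

/-! ### The Gaussian heat flow -/

/-- The standard Gaussian measure on `ℝ²`. -/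
noncomputable def gauss : Measure (Fin 2 → ℝ) :=
  Measure.pi fun _ => ProbabilityTheory.gaussianReal 0 1

instance : IsProbabilityMeasure gauss := by unfold gauss; infer_instance

/-- The heat flow `e^{tΔ} f`, as an average of translates of `f` over a Gaussian of covariance
`2t`. In this form it is visibly a contraction in every translation invariant norm. -/
noncomputable def heatFlow (t : ℝ) (f : Torus2 → ℝ) (x : Torus2) : ℝ :=
  ∫ z, f (x + toTorus (√(2 * t) • z)) ∂gauss

lemma exists_norm_bound {E : Type*} [NormedAddCommGroup E] {f : Torus2 → E} (hf : Continuous f) :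
    ∃ C, ∀ x, ‖f x‖ ≤ C := by
  obtain ⟨C, hC⟩ := (isCompact_univ (X := Torus2)).exists_bound_of_continuousOn hf.continuousOn
  exact ⟨C, fun x => hC x (mem_univ x)⟩

lemma integrable_of_continuous {E : Type*} [NormedAddCommGroup E] {f : Torus2 → E}
    (hf : Continuous f) {α : Type*} [TopologicalSpace α] [MeasurableSpace α]
    [OpensMeasurableSpace α] [SecondCountableTopology α] {μ : Measure α} [IsFiniteMeasure μ]
    {τ : α → Torus2} (hτ : Continuous τ) : Integrable (fun z => f (τ z)) μ := by
  obtain ⟨C, hC⟩ := exists_norm_bound hf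
  exact Integrable.of_bound (hf.comp hτ).aestronglyMeasurable C
    (Eventually.of_forall fun z => hC _)

lemma integrable_heatFlow {f : Torus2 → ℝ} (hf : Continuous f) (t : ℝ) (x : Torus2) :
    Integrable (fun z => f (x + toTorus (√(2 * t) • z))) gauss :=
  integrable_of_continuous hf (τ := fun z => x + toTorus (√(2 * t) • z)) (by fun_prop)

lemma continuous_heatFlow {f : Torus2 → ℝ} (hf : Continuous f) (t : ℝ) :
    Continuous (heatFlow t f) := by
  obtain ⟨C, hC⟩ := exists_norm_bound hf
  refine continuous_of_dominated (bound := fun _ => C)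
    (fun x => (integrable_heatFlow hf t x).aestronglyMeasurable)
    (fun x => Eventually.of_forall fun z => hC _) (integrable_const C)
    (Eventually.of_forall fun z => ?_)
  fun_prop

lemma heatFlow_sub {f g : Torus2 → ℝ} (hf : Continuous f) (hg : Continuous g) (t : ℝ) :
    heatFlow t (f - g) = heatFlow t f - heatFlow t g := by
  ext x
  exact integral_sub (integrable_heatFlow hf t x) (integrable_heatFlow hg t x)

lemma heatFlow_zero (f : Torus2 → ℝ) : heatFlow 0 f = f := by
  ext x
  simp [heatFlow, toTorus_zero]

lemma enorm_integral_gauss_le {f : (Fin 2 → ℝ) → ℝ} {c : ℝ≥0∞} (h : ∀ z, ‖f z‖ₑ ≤ c) :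
    ‖∫ z, f z ∂gauss‖ₑ ≤ c := by
  refine (enorm_integral_le_lintegral_enorm _).trans ?_
  calc ∫⁻ z, ‖f z‖ₑ ∂gauss ≤ ∫⁻ _, c ∂gauss := lintegral_mono h
    _ = c := by simp

lemma holderWith_heatFlow {η C : ℝ≥0} {f : Torus2 → ℝ} (hf : Continuous f)
    (h : HolderWith C η f) (t : ℝ) : HolderWith C η (heatFlow t f) := by
  intro x y
  rw [edist_eq_enorm_sub, heatFlow, heatFlow,
    ← integral_sub (integrable_heatFlow hf t x) (integrable_heatFlow hf t y)]
  refine enorm_integral_gauss_le fun z => ?_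
  rw [← edist_eq_enorm_sub]
  simpa using h (x + toTorus (√(2 * t) • z)) (y + toTorus (√(2 * t) • z))

lemma holderNorm_heatFlow_le (η : ℝ≥0) {f : Torus2 → ℝ} (hf : Continuous f) (t : ℝ) :
    holderNorm η (heatFlow t f) ≤ holderNorm η f := by
  refine add_le_add ?_ ?_
  · exact iSup_le fun x => enorm_integral_gauss_le fun z => le_iSup (fun x => ‖f x‖ₑ) _
  · exact le_iInf₂ fun C hC => (holderWith_heatFlow hf hC t).eHolderNorm_le

lemma integrable_norm_gauss : Integrable (fun z => ‖z‖) gauss := by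
  have h : ∀ i : Fin 2, Integrable (fun z : Fin 2 → ℝ => ‖z i‖) gauss := fun i => by
    have h1 : Integrable (fun s : ℝ => ‖s‖) (ProbabilityTheory.gaussianReal 0 1) :=
      ((ProbabilityTheory.memLp_id_gaussianReal 1).integrable le_rfl).norm
    exact integrable_comp_eval (i := i) h1
  refine (integrable_finsetSum Finset.univ fun i _ => h i).mono'
    (by fun_prop) (Eventually.of_forall fun z => ?_)
  rw [norm_norm, pi_norm_le_iff_of_nonneg (by positivity)]
  exact fun i => Finset.single_le_sum (f := fun i => ‖z i‖) (fun _ _ => norm_nonneg _)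
    (Finset.mem_univ i)

lemma abs_heatFlow_sub_le {L : ℝ≥0} {φ : Torus2 → ℝ} (hφ : LipschitzWith L φ) (s t : ℝ)
    (x : Torus2) : |heatFlow s φ x - heatFlow t φ x| ≤
      L * |√(2 * s) - √(2 * t)| * ∫ z, ‖z‖ ∂gauss := by
  rw [heatFlow, heatFlow, ← integral_sub (integrable_heatFlow hφ.continuous s x)
    (integrable_heatFlow hφ.continuous t x), ← integral_const_mul, ← Real.norm_eq_abs]
  refine norm_integral_le_of_norm_le (integrable_norm_gauss.const_mul _)
    (Eventually.of_forall fun z => ?_)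
  refine (hφ.norm_sub_le _ _).trans ?_
  rw [mul_assoc]
  refine mul_le_mul_of_nonneg_left ?_ L.coe_nonneg
  rw [add_sub_add_left_eq_sub, sub_eq_add_neg, ← toTorus_neg, ← toTorus_add, ← sub_eq_add_neg,
    ← sub_smul]
  refine (norm_toTorus_le _).trans ?_
  rw [norm_smul, Real.norm_eq_abs]

/-- On smooth functions the heat flow is continuous in time in the Hölder norm, by interpolation
between the supremum norm and the Lipschitz seminorm. -/
lemma tendsto_holderNorm_heatFlow_sub_of_smooth {η : ℝ≥0} (hη1 : η < 1) {φ : Torus2 → ℝ}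
    (hφ : IsSmooth φ) (t : ℝ) :
    Tendsto (fun s => holderNorm η (heatFlow s φ - heatFlow t φ)) (𝓝 t) (𝓝 0) := by
  obtain ⟨L, hL⟩ := hφ.exists_lipschitz
  have hη1' : (η : ℝ) < 1 := hη1
  set A : ℝ → ℝ := fun s => L * |√(2 * s) - √(2 * t)| * ∫ z, ‖z‖ ∂gauss
  have hA0 : ∀ s, 0 ≤ A s := fun s => by positivity
  have hlip : ∀ s x y, |heatFlow s φ x - heatFlow s φ y| ≤ L * dist x y := by
    intro s x y
    have h1 := holderWith_heatFlow hφ.continuous (holderWith_one.2 hL) s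
    exact (holderWith_one.1 h1).dist_le_mul x y
  have hbound : ∀ s, holderNorm η (heatFlow s φ - heatFlow t φ) ≤
      ENNReal.ofReal (A s + (2 * A s) ^ (1 - (η : ℝ)) * (2 * L) ^ (η : ℝ)) := by
    intro s
    have h1 : ∀ x, |(heatFlow s φ - heatFlow t φ) x| ≤ A s := abs_heatFlow_sub_le hL s t
    refine holderNorm_le (hA0 s) (by have := hA0 s; positivity) h1 fun x y => ?_
    rw [mul_assoc, ← Real.mul_rpow (by positivity) dist_nonneg]
    refine le_rpow_mul_rpow (abs_nonneg _) ?_ ?_ η.coe_nonneg hη1'.le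
    · exact (abs_sub _ _).trans (by linarith [h1 x, h1 y])
    · have h2 := hlip s x y
      have h3 := hlip t x y
      simp only [Pi.sub_apply]
      rw [sub_sub_sub_comm]
      exact (abs_sub _ _).trans (by linarith)
  have hA : Tendsto A (𝓝 t) (𝓝 0) := by
    have : Continuous A := by fun_prop
    simpa [A] using this.tendsto t
  have hlim : Tendsto (fun s => A s + (2 * A s) ^ (1 - (η : ℝ)) * (2 * L : ℝ) ^ (η : ℝ)) (𝓝 t)
      (𝓝 0) := by
    have h1 : Tendsto (fun s => (2 * A s) ^ (1 - (η : ℝ))) (𝓝 t) (𝓝 0) := by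
      have := (hA.const_mul 2).rpow_const (p := 1 - (η : ℝ)) (Or.inr (by linarith))
      rwa [mul_zero, Real.zero_rpow (by linarith)] at this
    simpa using hA.add (h1.mul_const ((2 * L : ℝ) ^ (η : ℝ)))
  have := ENNReal.tendsto_ofReal hlim
  rw [ENNReal.ofReal_zero] at this
  exact tendsto_of_tendsto_of_tendsto_of_le_of_le tendsto_const_nhds this
    (fun _ => zero_le) hbound

/-- Density of smooth functions and contractivity extend the time continuity to the whole
Hölder space. -/
theorem tendsto_holderNorm_heatFlow_sub {η : ℝ≥0} (hη0 : 0 < η) (hη1 : η < 1) {f : Torus2 → ℝ}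
    (hf : f ∈ HolderSpace η) (t : ℝ) :
    Tendsto (fun s => holderNorm η (heatFlow s f - heatFlow t f)) (𝓝 t) (𝓝 0) := by
  have hfc := continuous_of_mem_holderSpace hη0 hf
  rw [ENNReal.tendsto_nhds_zero]
  intro ε hε
  have hε3 : 0 < ε / 3 := ENNReal.div_pos hε.ne' (by simp)
  obtain ⟨φ, hφ, h1⟩ := hf (ε / 3) hε3
  filter_upwards [ENNReal.tendsto_nhds_zero.1
    (tendsto_holderNorm_heatFlow_sub_of_smooth hη1 hφ t) _ hε3] with s hs
  have hdec : heatFlow s f - heatFlow t f = heatFlow s (f - φ) +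
      (heatFlow s φ - heatFlow t φ) + heatFlow t (φ - f) := by
    rw [heatFlow_sub hfc hφ.continuous, heatFlow_sub hφ.continuous hfc]
    abel
  rw [hdec]
  calc _ ≤ ε / 3 + ε / 3 + ε / 3 := by
        refine (holderNorm_add_le _ _ _).trans (add_le_add ((holderNorm_add_le _ _ _).trans
          (add_le_add ?_ hs)) ?_)
        · exact (holderNorm_heatFlow_le η (hfc.sub hφ.continuous) s).trans h1.le
        · refine (holderNorm_heatFlow_le η (hφ.continuous.sub hfc) t).trans ?_
          rw [holderNorm_sub_comm]
          exact h1.le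
    _ = ε := ENNReal.add_thirds ε

/-! ### Fourier coefficients of the heat flow -/

/-- A continuous real function as a complex-valued continuous map. -/
noncomputable def complexify (f : Torus2 → ℝ) (hf : Continuous f) : C(Torus2, ℂ) :=
  ⟨fun x => (f x : ℂ), Complex.continuous_ofReal.comp hf⟩

lemma fourierCLM_toL2 (n : Fin 2 → ℤ) (f : C(Torus2, ℂ)) :
    fourierCLM n (toL2 f) = ∫ x, f x * starRingEnd ℂ (mFourier n x) :=
  ContinuousMap.inner_toLp volume _ _

/-- Translating a function multiplies its Fourier coefficient by a phase. -/
lemma integral_translate_mul_conj_mFourier (f : Torus2 → ℂ) (n : Fin 2 → ℤ) (τ : Torus2) :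
    ∫ x, f (x + τ) * starRingEnd ℂ (mFourier n x) =
      mFourier n τ * ∫ x, f x * starRingEnd ℂ (mFourier n x) := by
  rw [← integral_const_mul, ← integral_sub_right_eq_self _ τ]
  refine integral_congr_ae (Eventually.of_forall fun x => ?_)
  simp only [sub_add_cancel]
  have h2 : mFourier n x = mFourier n (x - τ) * mFourier n τ := by
    rw [← mFourier_add_apply, sub_add_cancel]
  have h3 : mFourier n τ * starRingEnd ℂ (mFourier n τ) = 1 := by
    rw [Complex.mul_conj, Complex.normSq_eq_norm_sq, norm_mFourier_apply]
    simp
  rw [h2, map_mul]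
  linear_combination (-(f x) * starRingEnd ℂ (mFourier n (x - τ))) * h3

lemma integral_mFourier_gauss (n : Fin 2 → ℤ) {t : ℝ} (ht : 0 ≤ t) :
    ∫ z, mFourier n (toTorus (√(2 * t) • z)) ∂gauss = (Real.exp (-eigenvalue n * t) : ℂ) := by
  have h1 : ∀ z : Fin 2 → ℝ, mFourier n (toTorus (√(2 * t) • z)) =
      ∏ i, Complex.exp (((2 * Real.pi * n i * √(2 * t) : ℝ) : ℂ) * z i * Complex.I) := by
    intro z
    rw [mFourier_toTorus, phase, ← Complex.exp_sum]
    congr 1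
    push_cast
    rw [Finset.mul_sum]
    refine Finset.sum_congr rfl fun i _ => ?_
    simp
    ring
  simp only [h1]
  rw [gauss, integral_fintype_prod_eq_prod (f := fun i (s : ℝ) =>
    Complex.exp (((2 * Real.pi * n i * √(2 * t) : ℝ) : ℂ) * s * Complex.I))]
  simp only [← charFun_apply_real, ProbabilityTheory.charFun_gaussianReal]
  rw [← Complex.exp_sum, Complex.ofReal_exp]
  congr 1
  have hs : (√(2 * t)) ^ 2 = 2 * t := Real.sq_sqrt (by linarith)
  have hs' : ((√(2 * t) : ℝ) : ℂ) ^ 2 = 2 * t := by exact_mod_cast hs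
  simp only [eigenvalue]
  push_cast
  rw [← Finset.sum_neg_distrib, Finset.sum_mul]
  refine Finset.sum_congr rfl fun i _ => ?_
  simp only [mul_pow, hs']
  ring

theorem fourierCLM_heatFlow {f : Torus2 → ℝ} (hf : Continuous f) (n : Fin 2 → ℤ) {t : ℝ}
    (ht : 0 ≤ t) : fourierCLM n (toL2 (complexify (heatFlow t f) (continuous_heatFlow hf t))) =
      (Real.exp (-eigenvalue n * t) : ℂ) * fourierCLM n (toL2 (complexify f hf)) := by
  rw [fourierCLM_toL2, fourierCLM_toL2]
  have h1 : ∀ x, complexify (heatFlow t f) (continuous_heatFlow hf t) x *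
      starRingEnd ℂ (mFourier n x) = ∫ z, (f (x + toTorus (√(2 * t) • z)) : ℂ) *
        starRingEnd ℂ (mFourier n x) ∂gauss := by
    intro x
    rw [integral_mul_const]
    congr 1
    exact integral_ofReal.symm
  simp only [h1]
  rw [integral_integral_swap, ← integral_mFourier_gauss n ht, ← integral_mul_const]
  · refine integral_congr_ae (Eventually.of_forall fun z => ?_)
    exact integral_translate_mul_conj_mFourier (fun x => (f x : ℂ)) n _
  · have hF : Continuous fun p : Torus2 × Torus2 =>
        (f (p.1 + p.2) : ℂ) * starRingEnd ℂ (mFourier n p.1) := by fun_prop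
    obtain ⟨C, hC⟩ := (isCompact_univ (X := Torus2 × Torus2)).exists_bound_of_continuousOn
      hF.continuousOn
    have hG : Continuous fun p : Torus2 × (Fin 2 → ℝ) =>
        (f (p.1 + toTorus (√(2 * t) • p.2)) : ℂ) * starRingEnd ℂ (mFourier n p.1) := by fun_prop
    exact Integrable.of_bound hG.aestronglyMeasurable C
      (Eventually.of_forall fun p => hC (p.1, toTorus (√(2 * t) • p.2)) (mem_univ _))

lemma unweight_heatOp {η : ℝ} (hη0 : 0 < η) (hη1 : η < 1) {r : ℝ} (hr : 0 < r) (f : L2Torus)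
    (n : Fin 2 → ℤ) : unweight η (heatOp η hη0 hη1 r f) n =
      (Real.exp (-eigenvalue n * r) : ℂ) * fourierCLM n f := by
  rw [unweight, heatOp_apply hη0 hη1 hr, ← mul_assoc, ← Complex.ofReal_mul, ← mul_assoc,
    ← Real.rpow_add (bracket_pos n)]
  simp

/-- For positive times the Gaussian flow agrees with the Fourier multiplier, hence takes values in
the Hölder space. -/
theorem heatFlow_mem_holderSpace {η : ℝ≥0} (hη0 : 0 < η) (hη1 : η < 1) {f : Torus2 → ℝ}
    (hf : f ∈ HolderSpace η) {t : ℝ} (ht : 0 ≤ t) : heatFlow t f ∈ HolderSpace η := by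
  have hη0' : (0 : ℝ) < η := hη0
  have hη1' : (η : ℝ) < 1 := hη1
  have hfc := continuous_of_mem_holderSpace hη0 hf
  rcases ht.eq_or_lt with rfl | ht'
  · rwa [heatFlow_zero]
  · have h : complexify (heatFlow t f) (continuous_heatFlow hfc t) =
        synth η hη0' (heatOp η hη0' hη1' t (toL2 (complexify f hfc))) := by
      apply toL2_injective
      apply ext_fourierCLM
      intro n
      rw [fourierCLM_synth, unweight_heatOp hη0' hη1' ht', fourierCLM_heatFlow hfc n ht]
    have h2 : heatFlow t f = reFun (complexify (heatFlow t f) (continuous_heatFlow hfc t)) := by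
      ext x
      simp [reFun, complexify]
    rw [h2, h]
    exact synth_mem_holderSpace hη0' hη1' _

/-! ### Partial derivatives and the Laplacian on the torus -/

/-- The partial derivative of a function on the torus along the `i`-th axis. -/
noncomputable def torusDeriv (i : Fin 2) (φ : Torus2 → ℝ) (x : Torus2) : ℝ :=
  deriv (fun s : ℝ => φ (x + toTorus (Pi.single i s))) 0

lemma IsSmooth.hasDerivAt {φ : Torus2 → ℝ} (hφ : IsSmooth φ) (i : Fin 2) (a : Fin 2 → ℝ) (s : ℝ) :
    HasDerivAt (fun s : ℝ => φ (toTorus a + toTorus (Pi.single i s)))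
      (fderiv ℝ (fun y => φ (toTorus y)) (a + Pi.single i s) (Pi.single i 1)) s := by
  have h1 : HasFDerivAt (fun y => φ (toTorus y)) (fderiv ℝ (fun y => φ (toTorus y))
      (a + Pi.single i s)) (a + Pi.single i s) :=
    (hφ.differentiable (by simp) _).hasFDerivAt
  have h2 : HasDerivAt (fun s : ℝ => a + (Pi.single i s : Fin 2 → ℝ)) (Pi.single i 1) s :=
    (hasDerivAt_single i s).const_add a
  simpa only [Function.comp_def, toTorus_add] using h1.comp_hasDerivAt s h2

lemma IsSmooth.torusDeriv_toTorus {φ : Torus2 → ℝ} (hφ : IsSmooth φ) (i : Fin 2)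
    (a : Fin 2 → ℝ) : torusDeriv i φ (toTorus a) =
      fderiv ℝ (fun y => φ (toTorus y)) a (Pi.single i 1) := by
  have h := (hφ.hasDerivAt i a 0).deriv
  rw [Pi.single_zero, add_zero] at h
  exact h

lemma IsSmooth.torusDeriv {φ : Torus2 → ℝ} (hφ : IsSmooth φ) (i : Fin 2) :
    IsSmooth (torusDeriv i φ) := by
  simp only [IsSmooth, hφ.torusDeriv_toTorus]
  exact (hφ.fderiv_right (m := ∞) (by simp)).clm_apply contDiff_const

lemma IsSmooth.hasDerivAt_torusDeriv {φ : Torus2 → ℝ} (hφ : IsSmooth φ) (i : Fin 2) (x : Torus2)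
    (s : ℝ) : HasDerivAt (fun s : ℝ => φ (x + toTorus (Pi.single i s)))
      (DetGPAM.torusDeriv i φ (x + toTorus (Pi.single i s))) s := by
  obtain ⟨a, rfl, -⟩ := exists_toTorus_eq x
  rw [← toTorus_add, hφ.torusDeriv_toTorus]
  exact hφ.hasDerivAt i a s

lemma IsSmooth.laplacian_eq {φ : Torus2 → ℝ} (hφ : IsSmooth φ) :
    laplacian φ = fun x => ∑ i, DetGPAM.torusDeriv i (DetGPAM.torusDeriv i φ) x := by
  ext x
  refine Finset.sum_congr rfl fun i _ => ?_
  have h : deriv (fun s : ℝ => φ (x + toTorus (Pi.single i s))) =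
      fun s => DetGPAM.torusDeriv i φ (x + toTorus (Pi.single i s)) :=
    funext fun s => (hφ.hasDerivAt_torusDeriv i x s).deriv
  rw [iteratedDeriv_succ, iteratedDeriv_one, h]
  rfl

lemma IsSmooth.continuous_laplacian {φ : Torus2 → ℝ} (hφ : IsSmooth φ) :
    Continuous (laplacian φ) := by
  rw [hφ.laplacian_eq]
  exact continuous_finsetSum _ fun i _ => ((hφ.torusDeriv i).torusDeriv i).continuous

lemma mFourier_single_apply (n : Fin 2 → ℤ) (i : Fin 2) (s : ℝ) :
    mFourier n (toTorus (Pi.single i s)) =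
      Complex.exp ((2 * Real.pi * n i * Complex.I) * s) := by
  rw [mFourier_toTorus, phase, Finset.sum_eq_single i]
  · congr 1
    simp
    ring
  · intro j _ hj
    simp [hj]
  · simp

lemma hasDerivAt_mFourier_single (n : Fin 2 → ℤ) (i : Fin 2) :
    HasDerivAt (fun s : ℝ => mFourier n (toTorus (Pi.single i s)))
      (2 * Real.pi * n i * Complex.I) 0 := by
  simp only [mFourier_single_apply]
  have h := ((Complex.ofRealCLM.hasDerivAt (x := (0 : ℝ))).const_mul
    (2 * Real.pi * n i * Complex.I)).cexp
  simpa using h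

/-- Differentiation becomes multiplication on the Fourier side: by translation invariance,
`∫ φ(x + s eᵢ) conj (eₙ x) dx` is an explicit function of `s`, which is differentiated at `0`. -/
lemma fourierCLM_torusDeriv {φ : Torus2 → ℝ} (hφ : IsSmooth φ) (i : Fin 2) (n : Fin 2 → ℤ) :
    fourierCLM n (toL2 (complexify (torusDeriv i φ) (hφ.torusDeriv i).continuous)) =
      (2 * Real.pi * n i * Complex.I) *
        fourierCLM n (toL2 (complexify φ hφ.continuous)) := by
  rw [fourierCLM_toL2, fourierCLM_toL2]
  have hφc := hφ.continuous
  have hdc := (hφ.torusDeriv i).continuous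
  obtain ⟨C, hC⟩ := exists_norm_bound hdc
  have h1 := hasDerivAt_integral_of_dominated_loc_of_deriv_le (𝕜 := ℝ) (μ := volume) (x₀ := (0 : ℝ))
    (s := univ) (bound := fun _ => C)
    (F := fun (s : ℝ) x => (φ (x + toTorus (Pi.single i s)) : ℂ) * starRingEnd ℂ (mFourier n x))
    (F' := fun (s : ℝ) x => (torusDeriv i φ (x + toTorus (Pi.single i s)) : ℂ) *
      starRingEnd ℂ (mFourier n x)) univ_mem
    (Eventually.of_forall fun s => (by fun_prop : Continuous fun x : Torus2 =>
      (φ (x + toTorus (Pi.single i s)) : ℂ) * starRingEnd ℂ (mFourier n x)).aestronglyMeasurable)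
    (integrable_of_continuous (f := fun x : Torus2 =>
      (φ (x + toTorus (Pi.single i 0)) : ℂ) * starRingEnd ℂ (mFourier n x)) (by fun_prop)
      continuous_id)
    (by fun_prop : Continuous fun x : Torus2 => (torusDeriv i φ (x + toTorus (Pi.single i 0)) : ℂ) *
      starRingEnd ℂ (mFourier n x)).aestronglyMeasurable
    (Eventually.of_forall fun x s _ => by
      rw [norm_mul, RCLike.norm_conj, norm_mFourier_apply, mul_one, Complex.norm_real]
      exact hC _)
    (integrable_const C)
    (Eventually.of_forall fun x s _ =>
      ((hφ.hasDerivAt_torusDeriv i x s).ofReal_comp).mul_const _)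
  have h2 : ∀ s : ℝ, ∫ x, (φ (x + toTorus (Pi.single i s)) : ℂ) * starRingEnd ℂ (mFourier n x) =
      mFourier n (toTorus (Pi.single i s)) * ∫ x, (φ x : ℂ) * starRingEnd ℂ (mFourier n x) :=
    fun s => integral_translate_mul_conj_mFourier (fun x => (φ x : ℂ)) n _
  have h3 := h1.2
  simp only [h2] at h3
  have h4 := h3.unique ((hasDerivAt_mFourier_single n i).mul_const _)
  simp only [Pi.single_zero, toTorus_zero, add_zero] at h4
  exact h4

theorem fourierCLM_laplacian {φ : Torus2 → ℝ} (hφ : IsSmooth φ) (n : Fin 2 → ℤ) :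
    fourierCLM n (toL2 (complexify (laplacian φ) hφ.continuous_laplacian)) =
      -(eigenvalue n : ℂ) * fourierCLM n (toL2 (complexify φ hφ.continuous)) := by
  have h1 : complexify (laplacian φ) hφ.continuous_laplacian = ∑ i, complexify
      (torusDeriv i (torusDeriv i φ)) ((hφ.torusDeriv i).torusDeriv i).continuous := by
    ext x
    simp [complexify, hφ.laplacian_eq]
  rw [h1, map_sum toL2, map_sum (fourierCLM n)]
  simp only [fourierCLM_torusDeriv (hφ.torusDeriv _), fourierCLM_torusDeriv hφ, eigenvalue,
    Fin.sum_univ_two]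
  push_cast
  linear_combination (fourierCLM n (toL2 (complexify φ hφ.continuous)) *
    ((2 * Real.pi * n 0 : ℂ) ^ 2 + (2 * Real.pi * n 1 : ℂ) ^ 2)) * Complex.I_mul_I

lemma torusDeriv_re_mFourier (i : Fin 2) (n : Fin 2 → ℤ) (c : ℂ) :
    torusDeriv i (fun x => (c * mFourier n x).re) =
      fun x => ((c * (2 * Real.pi * n i * Complex.I)) * mFourier n x).re := by
  ext x
  have h := ((hasDerivAt_mFourier_single n i).const_mul (c * mFourier n x))
  have h2 := (Complex.reCLM.hasFDerivAt.comp_hasDerivAt (0 : ℝ) h).deriv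
  simp only [Function.comp_def, Complex.reCLM_apply] at h2
  simp only [torusDeriv, mFourier_add_apply, ← mul_assoc c] at h2 ⊢
  rw [h2]
  congr 1
  ring

lemma laplacian_re_mFourier (n : Fin 2 → ℤ) (c : ℂ) :
    laplacian (fun x => (c * mFourier n x).re) =
      fun x => -eigenvalue n * (c * mFourier n x).re := by
  rw [(isSmooth_re_mFourier n c).laplacian_eq]
  ext x
  simp only [torusDeriv_re_mFourier, eigenvalue]
  rw [← Finset.sum_neg_distrib, Finset.sum_mul]
  refine Finset.sum_congr rfl fun i _ => ?_
  rw [← Complex.re_ofReal_mul]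
  congr 1
  push_cast
  linear_combination (c * mFourier n x * (2 * Real.pi * n i : ℂ) ^ 2) * Complex.I_mul_I

/-! ### The scalar equation of one Fourier mode -/

/-- Duhamel's formula for the scalar equation `y' = -l y + f`. -/
lemma duhamel_scalar_iff {T l : ℝ} {y f : ℝ → ℂ} (hy : Continuous y) (hf : Continuous f) (y₀ : ℂ) :
    (∀ t ∈ Icc 0 T, y t = y₀ + ∫ s in (0 : ℝ)..t, (-(l : ℂ) * y s + f s)) ↔
    ∀ t ∈ Icc 0 T, y t = (Real.exp (-l * t) : ℂ) * y₀ +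
      ∫ r in (0 : ℝ)..t, (Real.exp (-l * r) : ℂ) * f (t - r) := by
  have hder : ∀ k t : ℝ, HasDerivAt (fun t : ℝ => (Real.exp (k * t) : ℂ))
      ((Real.exp (k * t) : ℂ) * k) t := fun k t => by
    have := (((hasDerivAt_id t).const_mul k).exp).ofReal_comp
    simpa using this
  have hexp : ∀ t : ℝ, (Real.exp (-l * t) : ℂ) * (Real.exp (l * t) : ℂ) = 1 := fun t => by
    rw [← Complex.ofReal_mul, ← Real.exp_add]
    simp
  have hgc : Continuous fun s : ℝ => (Real.exp (l * s) : ℂ) * f s := by fun_prop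
  have hm : ∀ t : ℝ, ∫ r in (0 : ℝ)..t, (Real.exp (-l * r) : ℂ) * f (t - r) =
      (Real.exp (-l * t) : ℂ) * ∫ s in (0 : ℝ)..t, (Real.exp (l * s) : ℂ) * f s := by
    intro t
    have := intervalIntegral.integral_comp_sub_left (a := 0) (b := t)
      (fun s => (Real.exp (-l * t) : ℂ) * ((Real.exp (l * s) : ℂ) * f s)) t
    rw [sub_self, sub_zero] at this
    rw [← intervalIntegral.integral_const_mul, ← this]
    refine intervalIntegral.integral_congr fun r _ => ?_
    rw [← mul_assoc, ← Complex.ofReal_mul, ← Real.exp_add]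
    ring_nf
  simp only [hm]
  constructor
  · intro h t ht
    set Y : ℝ → ℂ := fun t => y₀ + ∫ s in (0 : ℝ)..t, (-(l : ℂ) * y s + f s)
    have hY : ∀ t, HasDerivAt Y (-(l : ℂ) * y t + f t) t := fun t =>
      ((by fun_prop : Continuous fun s => -(l : ℂ) * y s + f s).integral_hasStrictDerivAt
        0 t).hasDerivAt.const_add y₀
    have hYc : Continuous Y := continuous_iff_continuousAt.2 fun t => (hY t).continuousAt
    have h1 := intervalIntegral.integral_eq_sub_of_hasDerivAt (a := 0) (b := t)
      (fun s _ => (hder l s).mul (hY s))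
      ((by fun_prop : Continuous fun s : ℝ => (Real.exp (l * s) : ℂ) * l * Y s +
        (Real.exp (l * s) : ℂ) * (-(l : ℂ) * y s + f s)).intervalIntegrable 0 t)
    have h2 : ∫ s in (0 : ℝ)..t, ((Real.exp (l * s) : ℂ) * l * Y s +
        (Real.exp (l * s) : ℂ) * (-(l : ℂ) * y s + f s)) =
        ∫ s in (0 : ℝ)..t, (Real.exp (l * s) : ℂ) * f s := by
      refine intervalIntegral.integral_congr fun s hs => ?_
      rw [uIcc_of_le ht.1] at hs
      have h3 : Y s = y s := (h s ⟨hs.1, hs.2.trans ht.2⟩).symm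
      simp only [h3]
      ring
    have h0 : Y 0 = y₀ := by simp [Y]
    have h3 : y t = Y t := h t ht
    rw [← h2, h1, h3]
    simp only [Pi.mul_apply]
    rw [h0, mul_sub, ← mul_assoc, hexp]
    simp
  · intro h t ht
    set m : ℝ → ℂ := fun t => (Real.exp (-l * t) : ℂ) * y₀ +
      (Real.exp (-l * t) : ℂ) * ∫ s in (0 : ℝ)..t, (Real.exp (l * s) : ℂ) * f s
    have hmd : ∀ t, HasDerivAt m (-(l : ℂ) * m t + f t) t := by
      intro t
      have h1 := (hgc.integral_hasStrictDerivAt 0 t).hasDerivAt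
      have h2 := ((hder (-l) t).mul_const y₀).add ((hder (-l) t).mul h1)
      convert! h2 using 1
      simp only [m]
      push_cast
      have := hexp t
      push_cast at this
      linear_combination (-(f t)) * this
    have hmc : Continuous m := continuous_iff_continuousAt.2 fun t => (hmd t).continuousAt
    have h1 := intervalIntegral.integral_eq_sub_of_hasDerivAt (a := 0) (b := t)
      (fun s _ => hmd s) ((by fun_prop : Continuous fun s : ℝ =>
        -(l : ℂ) * m s + f s).intervalIntegrable 0 t)
    have h2 : ∫ s in (0 : ℝ)..t, (-(l : ℂ) * y s + f s) =
        ∫ s in (0 : ℝ)..t, (-(l : ℂ) * m s + f s) := by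
      refine intervalIntegral.integral_congr fun s hs => ?_
      rw [uIcc_of_le ht.1] at hs
      simp only [h s ⟨hs.1, hs.2.trans ht.2⟩]
      rfl
    rw [h2, h1, h t ht]
    have h0 : m 0 = y₀ := by simp [m]
    rw [h0]
    simp [m]

/-! ### Weak, modewise and mild formulations -/

/-- The weak equation, tested against smooth functions, for a curve `W` of continuous functions
and a right-hand side `F` with values in `L²`. -/
def WeakEq (T : ℝ) (W : ℝ → C(Torus2, ℂ)) (u : C(Torus2, ℂ)) (F : ℝ → L2Torus) : Prop :=
  ∀ (φ : Torus2 → ℝ) (hφ : IsSmooth φ), ∀ t ∈ Icc 0 T,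
    inner ℂ (toL2 (complexify φ hφ.continuous)) (toL2 (W t)) =
      inner ℂ (toL2 (complexify φ hφ.continuous)) (toL2 u) + ∫ s in (0 : ℝ)..t,
        (inner ℂ (toL2 (complexify (laplacian φ) hφ.continuous_laplacian)) (toL2 (W s)) +
          inner ℂ (toL2 (complexify φ hφ.continuous)) (F s))

/-- The equation for every Fourier coefficient. -/
def ModeEq (T : ℝ) (W : ℝ → C(Torus2, ℂ)) (u : C(Torus2, ℂ)) (F : ℝ → L2Torus) : Prop :=
  ∀ n, ∀ t ∈ Icc 0 T, fourierCLM n (toL2 (W t)) = fourierCLM n (toL2 u) +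
    ∫ s in (0 : ℝ)..t, (-(eigenvalue n : ℂ) * fourierCLM n (toL2 (W s)) + fourierCLM n (F s))

/-- `conj eₙ = Re eₙ + i Re (i eₙ)`, so the complex exponentials are combinations of real test
functions. -/
lemma fourierCLM_eq_inner_add (n : Fin 2 → ℤ) (f : L2Torus) :
    fourierCLM n f =
      inner ℂ (toL2 (complexify _ (isSmooth_re_mFourier n 1).continuous)) f +
      Complex.I * inner ℂ (toL2 (complexify _ (isSmooth_re_mFourier n Complex.I).continuous)) f := by
  have h : (mFourier n : C(Torus2, ℂ)) =
      complexify _ (isSmooth_re_mFourier n 1).continuous +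
        (-Complex.I) • complexify _ (isSmooth_re_mFourier n Complex.I).continuous := by
    ext x
    apply Complex.ext <;> simp [complexify]
  rw [fourierCLM_apply]
  conv_lhs => rw [h]
  rw [map_add, map_smul, inner_add_left, inner_smul_left]
  simp

theorem WeakEq.modeEq {T : ℝ} {W : ℝ → C(Torus2, ℂ)} {u : C(Torus2, ℂ)} {F : ℝ → L2Torus}
    (hW : Continuous W) (hF : Continuous F) (h : WeakEq T W u F) : ModeEq T W u F := by
  intro n t ht
  have hlap : ∀ (c : ℂ) (f : L2Torus), inner ℂ (toL2 (complexify _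
      (isSmooth_re_mFourier n c).continuous_laplacian)) f =
        -(eigenvalue n : ℂ) * inner ℂ (toL2 (complexify _
          (isSmooth_re_mFourier n c).continuous)) f := by
    intro c f
    have h1 : complexify _ (isSmooth_re_mFourier n c).continuous_laplacian =
        (-(eigenvalue n : ℂ)) • complexify _ (isSmooth_re_mFourier n c).continuous := by
      ext x
      have := congrFun (laplacian_re_mFourier n c) x
      simp only [complexify, ContinuousMap.coe_mk, ContinuousMap.smul_apply, smul_eq_mul]
      rw [this]
      push_cast
      ring
    rw [h1, map_smul, inner_smul_left]
    simp
  have h1 := h _ (isSmooth_re_mFourier n 1) t ht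
  have h2 := h _ (isSmooth_re_mFourier n Complex.I) t ht
  simp only [hlap] at h1 h2
  simp only [fourierCLM_eq_inner_add]
  rw [h1, h2, mul_add, add_add_add_comm, ← intervalIntegral.integral_const_mul,
    ← intervalIntegral.integral_add]
  · congr 1
    refine intervalIntegral.integral_congr fun s _ => ?_
    ring
  · exact (by fun_prop : Continuous _).intervalIntegrable _ _
  · exact (by fun_prop : Continuous _).intervalIntegrable _ _

/-- By Parseval, testing against exponentials suffices. After integrating `W` and `F` in time as
`L²`-valued functions, no sum has to be exchanged with the time integral. -/
theorem ModeEq.weakEq {T : ℝ} {W : ℝ → C(Torus2, ℂ)} {u : C(Torus2, ℂ)} {F : ℝ → L2Torus}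
    (hW : Continuous W) (hF : Continuous F) (h : ModeEq T W u F) : WeakEq T W u F := by
  intro φ hφ t ht
  have hWi : IntervalIntegrable (fun s => toL2 (W s)) volume 0 t :=
    (by fun_prop : Continuous fun s => toL2 (W s)).intervalIntegrable _ _
  have hFi : IntervalIntegrable F volume 0 t := hF.intervalIntegrable _ _
  have hmode : ∀ n, fourierCLM n (toL2 (W t) - toL2 u - ∫ s in (0 : ℝ)..t, F s) =
      -(eigenvalue n : ℂ) * fourierCLM n (∫ s in (0 : ℝ)..t, toL2 (W s)) := by
    intro n
    rw [map_sub, map_sub, h n t ht, ← ContinuousLinearMap.intervalIntegral_comp_comm _ hWi,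
      ← ContinuousLinearMap.intervalIntegral_comp_comm _ hFi, intervalIntegral.integral_add,
      intervalIntegral.integral_const_mul]
    · ring
    · exact (by fun_prop : Continuous _).intervalIntegrable _ _
    · exact (by fun_prop : Continuous _).intervalIntegrable _ _
  have key : inner ℂ (toL2 (complexify φ hφ.continuous))
        (toL2 (W t) - toL2 u - ∫ s in (0 : ℝ)..t, F s) =
      inner ℂ (toL2 (complexify (laplacian φ) hφ.continuous_laplacian))
        (∫ s in (0 : ℝ)..t, toL2 (W s)) := by
    have h2 := hasSum_inner_fourierCLM (toL2 (complexify (laplacian φ) hφ.continuous_laplacian))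
      (∫ s in (0 : ℝ)..t, toL2 (W s))
    refine (hasSum_inner_fourierCLM _ _).unique (h2.congr_fun fun n => ?_)
    rw [hmode, fourierCLM_laplacian hφ, map_mul, map_neg, Complex.conj_ofReal]
    ring
  have h1 : ∀ (f : L2Torus) {G : ℝ → L2Torus}, IntervalIntegrable G volume 0 t →
      inner ℂ f (∫ s in (0 : ℝ)..t, G s) = ∫ s in (0 : ℝ)..t, inner ℂ f (G s) := fun f G hG =>
    ((innerSL ℂ f).intervalIntegral_comp_comm hG).symm
  rw [inner_sub_right, inner_sub_right, h1 _ hWi, h1 _ hFi] at key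
  rw [intervalIntegral.integral_add]
  · linear_combination key
  · exact (by fun_prop : Continuous _).intervalIntegrable _ _
  · exact (by fun_prop : Continuous _).intervalIntegrable _ _

/-- The Fourier coefficients of the Duhamel term. -/
lemma fourierCLM_synth_duhamel {η : ℝ} (hη0 : 0 < η) (hη1 : η < 1) {T : ℝ} {F : ℝ → L2Torus}
    (hF : Continuous F) (n : Fin 2 → ℤ) {t : ℝ} (ht : t ∈ Icc 0 T) :
    fourierCLM n (toL2 (synth η hη0 (duhamel (heatOp η hη0 hη1) F t))) =
      ∫ r in (0 : ℝ)..t, (Real.exp (-eigenvalue n * r) : ℂ) * fourierCLM n (F (t - r)) := by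
  have hint := (isSmoothingFamily_heatOp hη0 hη1 T).intervalIntegrable_apply
    (G := fun r => F (t - r)) (by fun_prop) ht
  have h1 := (((fourierCLM n).comp toL2).restrictScalars ℝ).comp (synth η hη0)
    |>.intervalIntegral_comp_comm hint
  refine h1.symm.trans ?_
  refine intervalIntegral.integral_congr_ae (Eventually.of_forall fun r hr => ?_)
  rw [uIoc_of_le ht.1] at hr
  change fourierCLM n (toL2 (synth η hη0 (heatOp η hη0 hη1 r (F (t - r))))) = _
  rw [fourierCLM_synth, unweight_heatOp hη0 hη1 hr.1]

/-- The modewise equation is the Fourier transform of the mild equation. -/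
theorem modeEq_iff_mild {η : ℝ} (hη0 : 0 < η) (hη1 : η < 1) {T : ℝ} {W : ℝ → C(Torus2, ℂ)}
    (hW : Continuous W) {u : Torus2 → ℝ} (hu : Continuous u) {F : ℝ → L2Torus}
    (hF : Continuous F) :
    ModeEq T W (complexify u hu) F ↔ ∀ t ∈ Icc 0 T,
      W t = complexify (heatFlow t u) (continuous_heatFlow hu t) +
        synth η hη0 (duhamel (heatOp η hη0 hη1) F t) := by
  have h1 : ∀ t ∈ Icc 0 T, (W t = complexify (heatFlow t u) (continuous_heatFlow hu t) +
        synth η hη0 (duhamel (heatOp η hη0 hη1) F t) ↔ ∀ n, fourierCLM n (toL2 (W t)) =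
        (Real.exp (-eigenvalue n * t) : ℂ) * fourierCLM n (toL2 (complexify u hu)) +
        ∫ r in (0 : ℝ)..t, (Real.exp (-eigenvalue n * r) : ℂ) * fourierCLM n (F (t - r))) := by
    intro t ht
    rw [← toL2_injective.eq_iff]
    have h2 : ∀ n, fourierCLM n (toL2 (complexify (heatFlow t u) (continuous_heatFlow hu t) +
        synth η hη0 (duhamel (heatOp η hη0 hη1) F t))) =
        (Real.exp (-eigenvalue n * t) : ℂ) * fourierCLM n (toL2 (complexify u hu)) +
        ∫ r in (0 : ℝ)..t, (Real.exp (-eigenvalue n * r) : ℂ) * fourierCLM n (F (t - r)) := by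
      intro n
      rw [map_add, map_add, fourierCLM_heatFlow hu n ht.1,
        fourierCLM_synth_duhamel hη0 hη1 hF n ht]
    exact ⟨fun h n => by rw [h, h2], fun h => ext_fourierCLM fun n => by rw [h, h2]⟩
  have h3 := fun n => duhamel_scalar_iff (T := T) (l := eigenvalue n)
    (y := fun t => fourierCLM n (toL2 (W t))) (f := fun t => fourierCLM n (F t))
    (by fun_prop) (by fun_prop) (fourierCLM n (toL2 (complexify u hu)))
  refine (forall_congr' h3).trans ⟨fun h t ht => (h1 t ht).2 fun n => h n t ht,
    fun h n t ht => (h1 t ht).1 (h t ht) n⟩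

/-! ### The nonlinearity -/

lemma IsCb1.exists_lipschitz {g : ℝ → ℝ} (hg : IsCb1 g) : ∃ L : ℝ≥0, LipschitzWith L g := by
  obtain ⟨hd, M, hM⟩ := hg
  have hM0 : 0 ≤ M := (abs_nonneg _).trans (hM 0).1
  lift M to ℝ≥0 using hM0
  exact ⟨M, lipschitzWith_of_nnnorm_deriv_le (hd.differentiable (by simp)) fun y => (hM y).2⟩

lemma IsCb1.memLp {g : ℝ → ℝ} (hg : IsCb1 g) (h : Lp ℝ 2 (volume : Measure Torus2))
    (f : C(Torus2, ℂ)) :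
    MemLp (fun x => ((g (f x).re * h x : ℝ) : ℂ)) 2 (volume : Measure Torus2) := by
  obtain ⟨hd, M, hM⟩ := hg
  have hc : Continuous fun x => g (f x).re :=
    hd.continuous.comp (Complex.continuous_re.comp f.continuous)
  refine MemLp.of_le_mul (c := M) (Lp.memLp h) ?_ (Eventually.of_forall fun x => ?_)
  · exact Complex.continuous_ofReal.comp_aestronglyMeasurable
      (hc.aestronglyMeasurable.mul (Lp.aestronglyMeasurable h))
  · rw [Complex.norm_real, norm_mul]
    exact mul_le_mul_of_nonneg_right (hM _).1 (norm_nonneg _)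

/-- The right-hand side `g(Re f) h` as an `L²` function; on real `f` it is `g(f) h`. -/
noncomputable def nemytskii {g : ℝ → ℝ} (hg : IsCb1 g) (h : Lp ℝ 2 (volume : Measure Torus2))
    (f : C(Torus2, ℂ)) : L2Torus := (hg.memLp h f).toLp

lemma lipschitzWith_nemytskii {g : ℝ → ℝ} (hg : IsCb1 g)
    (h : Lp ℝ 2 (volume : Measure Torus2)) :
    ∃ L : ℝ≥0, LipschitzWith L (nemytskii hg h) := by
  obtain ⟨L, hL⟩ := hg.exists_lipschitz
  refine ⟨L * ‖h‖₊, LipschitzWith.of_dist_le_mul fun f f' => ?_⟩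
  have hb : ∀ᵐ x, ‖(nemytskii hg h f - nemytskii hg h f') x‖ ≤ (L * ‖f - f'‖) * ‖h x‖ := by
    filter_upwards [Lp.coeFn_sub (nemytskii hg h f) (nemytskii hg h f'),
      (hg.memLp h f).coeFn_toLp, (hg.memLp h f').coeFn_toLp] with x h1 h2 h3
    rw [h1, Pi.sub_apply, nemytskii, nemytskii, h2, h3, ← Complex.ofReal_sub, ← sub_mul,
      Complex.norm_real, norm_mul]
    refine mul_le_mul_of_nonneg_right ((hL.norm_sub_le _ _).trans ?_) (norm_nonneg _)
    refine mul_le_mul_of_nonneg_left ?_ L.coe_nonneg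
    rw [← Complex.sub_re]
    exact (Complex.abs_re_le_norm _).trans ((f - f').norm_coe_le_norm x)
  rw [dist_eq_norm, dist_eq_norm]
  refine (Lp.norm_le_mul_norm_of_ae_le_mul hb).trans (le_of_eq ?_)
  push_cast
  ring

/-! ### Integral form of the pairings -/

lemma inner_complexify_toL2 {φ : Torus2 → ℝ} (hφ : Continuous φ) (f : C(Torus2, ℂ)) :
    inner ℂ (toL2 (complexify φ hφ)) (toL2 f) = ∫ x, f x * φ x := by
  rw [ContinuousMap.inner_toLp]
  simp [complexify]

lemma re_inner_complexify_toL2 {φ : Torus2 → ℝ} (hφ : Continuous φ) (f : C(Torus2, ℂ)) :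
    (inner ℂ (toL2 (complexify φ hφ)) (toL2 f)).re = ∫ x, reFun f x * φ x := by
  rw [inner_complexify_toL2]
  have hi : Integrable (fun x => f x * (φ x : ℂ)) (volume : Measure Torus2) :=
    integrable_of_continuous (f := fun x => f x * (φ x : ℂ)) (by fun_prop) continuous_id
  refine (integral_re hi).symm.trans ?_
  simp [reFun]

lemma inner_complexify_complexify {φ v : Torus2 → ℝ} (hφ : Continuous φ) (hv : Continuous v) :
    inner ℂ (toL2 (complexify φ hφ)) (toL2 (complexify v hv)) = ((∫ x, v x * φ x : ℝ) : ℂ) := by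
  rw [inner_complexify_toL2]
  refine Eq.trans ?_ integral_ofReal
  simp [complexify]

lemma inner_complexify_nemytskii {g : ℝ → ℝ} (hg : IsCb1 g)
    (h : Lp ℝ 2 (volume : Measure Torus2)) {φ : Torus2 → ℝ} (hφ : Continuous φ)
    (f : C(Torus2, ℂ)) : inner ℂ (toL2 (complexify φ hφ)) (nemytskii hg h f) =
      ((∫ x, g (reFun f x) * h x * φ x : ℝ) : ℂ) := by
  rw [L2.inner_def]
  refine Eq.trans (integral_congr_ae ?_) integral_ofReal
  filter_upwards [ContinuousMap.coeFn_toLp (p := 2) (𝕜 := ℂ) volume (complexify φ hφ),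
    (hg.memLp h f).coeFn_toLp] with x h1 h2
  rw [h1, nemytskii, h2]
  simp [complexify, reFun]

/-- The spatial integral in the weak equation splits into its linear and nonlinear part. -/
lemma integral_weak_split {g : ℝ → ℝ} (hg : IsCb1 g) (h : Lp ℝ 2 (volume : Measure Torus2))
    {φ ψ v : Torus2 → ℝ} (hφ : Continuous φ) (hψ : Continuous ψ) (hv : Continuous v) :
    ∫ x, (v x * ψ x + g (v x) * h x * φ x) =
      (∫ x, v x * ψ x) + ∫ x, g (v x) * h x * φ x := by
  refine integral_add ?_ ?_
  · exact integrable_of_continuous (f := fun x => v x * ψ x) (by fun_prop) continuous_id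
  · obtain ⟨C, hC⟩ := exists_norm_bound hφ
    have h1 : Integrable (fun x => g (v x) * h x) (volume : Measure Torus2) := by
      have := ((hg.memLp h (complexify v hv)).integrable one_le_two).re
      simpa [complexify] using this
    exact h1.mul_bdd (c := C) hφ.aestronglyMeasurable (Eventually.of_forall hC)

/-- The time-integrated equation of `IsSolution`, for a single curve. -/
def RealWeakEq (T : ℝ) (g : ℝ → ℝ) (u₀ : Torus2 → ℝ) (h : Lp ℝ 2 (volume : Measure Torus2))
    (w : ℝ → Torus2 → ℝ) : Prop :=
  ∀ φ : Torus2 → ℝ, IsSmooth φ → ∀ t ∈ Icc 0 T,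
    ∫ x, w t x * φ x = (∫ x, u₀ x * φ x) +
      ∫ s in (0 : ℝ)..t, ∫ x, (w s x * laplacian φ x + g (w s x) * h x * φ x)

/-- The real part of a complex weak solution solves the real equation, since the right-hand side
only involves the real part. -/
lemma WeakEq.realWeakEq {T : ℝ} {g : ℝ → ℝ} (hg : IsCb1 g)
    (h : Lp ℝ 2 (volume : Measure Torus2)) {W : ℝ → C(Torus2, ℂ)} (hW : Continuous W)
    {u₀ : Torus2 → ℝ} (hu₀ : Continuous u₀)
    (hw : WeakEq T W (complexify u₀ hu₀) fun s => nemytskii hg h (W s)) :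
    RealWeakEq T g u₀ h fun t => reFun (W t) := by
  intro φ hφ t ht
  have hN : Continuous (nemytskii hg h) := (lipschitzWith_nemytskii hg h).choose_spec.continuous
  have h1 := congrArg Complex.re (hw φ hφ t ht)
  have hi : IntervalIntegrable (fun s =>
      inner ℂ (toL2 (complexify (laplacian φ) hφ.continuous_laplacian)) (toL2 (W s)) +
        inner ℂ (toL2 (complexify φ hφ.continuous)) (nemytskii hg h (W s))) volume 0 t :=
    (by fun_prop : Continuous _).intervalIntegrable _ _
  have h2 := Complex.reCLM.intervalIntegral_comp_comm hi
  simp only [Complex.reCLM_apply] at h2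
  rw [Complex.add_re, ← h2, re_inner_complexify_toL2, inner_complexify_complexify,
    Complex.ofReal_re] at h1
  rw [h1]
  congr 1
  refine intervalIntegral.integral_congr fun s _ => ?_
  simp only [Complex.add_re]
  rw [re_inner_complexify_toL2, inner_complexify_nemytskii, Complex.ofReal_re,
    integral_weak_split hg h hφ.continuous hφ.continuous_laplacian
      (v := reFun (W s)) (Complex.continuous_re.comp (W s).continuous)]

/-- A real solution is a complex weak solution. -/
lemma RealWeakEq.weakEq {T : ℝ} {g : ℝ → ℝ} (hg : IsCb1 g)
    (h : Lp ℝ 2 (volume : Measure Torus2)) {W : ℝ → C(Torus2, ℂ)}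
    {u₀ : Torus2 → ℝ} (hu₀ : Continuous u₀) {v : ℝ → Torus2 → ℝ}
    (hv : ∀ t ∈ Icc 0 T, Continuous (v t))
    (hW : ∀ t (ht : t ∈ Icc 0 T), W t = complexify (v t) (hv t ht))
    (hw : RealWeakEq T g u₀ h v) :
    WeakEq T W (complexify u₀ hu₀) fun s => nemytskii hg h (W s) := by
  intro φ hφ t ht
  have h1 := hw φ hφ t ht
  rw [hW t ht, inner_complexify_complexify, inner_complexify_complexify, h1, Complex.ofReal_add,
    ← intervalIntegral.integral_ofReal]
  congr 1
  refine intervalIntegral.integral_congr fun s hs => ?_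
  rw [uIcc_of_le ht.1] at hs
  have hs' : s ∈ Icc 0 T := ⟨hs.1, hs.2.trans ht.2⟩
  simp only
  rw [integral_weak_split hg h hφ.continuous hφ.continuous_laplacian (hv s hs'), hW s hs',
    inner_complexify_complexify, inner_complexify_nemytskii, Complex.ofReal_add]
  simp [reFun, complexify]

/-! ### Curves in the Hölder space -/

/-- Continuity in the Hölder norm implies continuity in the supremum norm. -/
lemma edist_complexify_le (η : ℝ≥0) {f f' : Torus2 → ℝ} (hf : Continuous f)
    (hf' : Continuous f') :
    edist (complexify f hf) (complexify f' hf') ≤ holderNorm η (f - f') := by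
  by_cases htop : holderNorm η (f - f') = ⊤
  · rw [htop]; exact le_top
  · rw [edist_dist, ENNReal.ofReal_le_iff_le_toReal htop,
      ContinuousMap.dist_le ENNReal.toReal_nonneg]
    intro x
    rw [← ENNReal.ofReal_le_iff_le_toReal htop, ← edist_dist, edist_eq_enorm_sub]
    refine le_trans (le_of_eq ?_) (enorm_apply_le_holderNorm η (f - f') x)
    simp only [complexify, ContinuousMap.coe_mk, Pi.sub_apply, ← Complex.ofReal_sub]
    rw [← ofReal_norm, ← ofReal_norm, Complex.norm_real]

/-- A curve that is continuous in the Hölder norm, as a continuous curve of continuous functions. -/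
lemma continuous_complexify_curve {T : ℝ} {η : ℝ≥0} {v : ℝ → Torus2 → ℝ}
    (hc : ∀ t ∈ Icc 0 T, Continuous (v t))
    (hv : ∀ t ∈ Icc 0 T, Tendsto (fun s => holderNorm η (v s - v t)) (𝓝[Icc 0 T] t) (𝓝 0)) :
    Continuous fun t : Icc 0 T => complexify (v t) (hc t t.2) := by
  refine continuous_iff_continuousAt.2 fun t => ?_
  rw [ContinuousAt, tendsto_iff_edist_tendsto_0]
  have h1 := (hv t t.2).comp (tendsto_nhdsWithin_iff.2
    ⟨(continuous_subtype_val (p := (· ∈ Icc 0 T))).tendsto t, Eventually.of_forall fun s => s.2⟩)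
  exact tendsto_of_tendsto_of_tendsto_of_le_of_le tendsto_const_nhds h1 (fun _ => zero_le)
    fun s => edist_complexify_le η _ _

/-- Solutions of the mild equation have continuous trajectories in the Hölder space. -/
theorem isContinuousCurve_mild {T : ℝ} {η : ℝ≥0} (hη0 : 0 < η) (hη1 : η < 1)
    {u₀ : Torus2 → ℝ} (hu₀ : u₀ ∈ HolderSpace η) {D : ℝ → WienerSeq}
    (hD : ContinuousOn D (Icc 0 T)) {w : ℝ → Torus2 → ℝ}
    (hw : ∀ t ∈ Icc 0 T, w t = heatFlow t u₀ + reFun (synth η hη0 (D t))) :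
    IsContinuousCurve T η w := by
  have hη0' : (0 : ℝ) < η := hη0
  have hη1' : (η : ℝ) < 1 := hη1
  refine ⟨fun t ht => ?_, fun t ht => ?_⟩
  · rw [hw t ht]
    exact HolderSpace.add (heatFlow_mem_holderSpace hη0 hη1 hu₀ ht.1)
      (synth_mem_holderSpace hη0' hη1' _)
  · have h1 := (tendsto_holderNorm_heatFlow_sub hη0 hη1 hu₀ t).mono_left
      (nhdsWithin_le_nhds (s := Icc 0 T))
    have h2 := ENNReal.tendsto_ofReal ((((hD t ht).tendsto.sub_const (D t)).norm).const_mul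
      (1 + 4 * Real.pi))
    have h3 := h1.add h2
    simp only [sub_self, norm_zero, mul_zero, ENNReal.ofReal_zero, add_zero] at h3
    refine tendsto_of_tendsto_of_tendsto_of_le_of_le' tendsto_const_nhds h3
      (Eventually.of_forall fun _ => zero_le) ?_
    filter_upwards [self_mem_nhdsWithin] with s hs
    have hdec : w s - w t = (heatFlow s u₀ - heatFlow t u₀) +
        reFun (synth η hη0 (D s - D t)) := by
      rw [hw s hs, hw t ht]
      ext x
      simp only [map_sub, reFun, Pi.sub_apply, Pi.add_apply, ContinuousMap.sub_apply,
        Complex.sub_re]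
      ring
    rw [hdec]
    exact (holderNorm_add_le _ _ _).trans
      (add_le_add le_rfl (holderNorm_synth_le hη0' hη1' _))

end DetGPAM

/-! ### Existence and uniqueness -/

open DetGPAM in
theorem mainTheorem11 (T : ℝ) (hT : 0 < T) (η : NNReal) (hη0 : 0 < η) (hη1 : η < 1)
    (g : ℝ → ℝ) (hg : DetGPAM.IsCb1 g)
    (u₀ : DetGPAM.Torus2 → ℝ) (hu₀ : u₀ ∈ DetGPAM.HolderSpace η)
    (h : MeasureTheory.Lp ℝ 2 (MeasureTheory.volume : MeasureTheory.Measure DetGPAM.Torus2)) :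
    ∃ w : ℝ → DetGPAM.Torus2 → ℝ, DetGPAM.IsSolution T η g u₀ h w ∧
      ∀ v : ℝ → DetGPAM.Torus2 → ℝ, DetGPAM.IsSolution T η g u₀ h v →
        ∀ t ∈ Set.Icc 0 T, v t = w t := by
  have hη0' : (0 : ℝ) < η := hη0
  have hη1' : (η : ℝ) < 1 := hη1
  have hu₀c := continuous_of_mem_holderSpace hη0 hu₀
  have hS := isSmoothingFamily_heatOp hη0' hη1' T
  obtain ⟨L, hL⟩ := lipschitzWith_nemytskii hg h
  let U : C(Icc 0 T, C(Torus2, ℂ)) :=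
    ⟨fun t => complexify (heatFlow t u₀) (continuous_heatFlow hu₀c t),
      continuous_complexify_curve (v := fun t => heatFlow t u₀) (η := η)
        (fun t _ => continuous_heatFlow hu₀c t)
        fun t _ => (tendsto_holderNorm_heatFlow_sub hη0 hη1 hu₀ t).mono_left nhdsWithin_le_nhds⟩
  obtain ⟨W, hW, hWu⟩ := hS.existsUnique_volterra hT.le hL (synth η hη0') U
  -- Curves on `[0, T]` are extended to all times by their end values.
  have hext : ∀ V : C(Icc 0 T, C(Torus2, ℂ)), Continuous fun t => V (projIcc 0 T hT.le t) :=
    fun V => V.continuous.comp continuous_projIcc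
  have hextN : ∀ V : C(Icc 0 T, C(Torus2, ℂ)),
      Continuous fun t => nemytskii hg h (V (projIcc 0 T hT.le t)) :=
    fun V => hL.continuous.comp (hext V)
  have hmild : ∀ t ∈ Icc 0 T, W (projIcc 0 T hT.le t) =
      complexify (heatFlow t u₀) (continuous_heatFlow hu₀c t) + synth η hη0'
        (duhamel (heatOp η hη0' hη1') (fun s => nemytskii hg h (W (projIcc 0 T hT.le s))) t) := by
    intro t ht
    rw [projIcc_of_mem hT.le ht]
    exact hW ⟨t, ht⟩
  refine ⟨fun t => reFun (W (projIcc 0 T hT.le t)), ⟨?_, ?_, ?_⟩, fun v hv t ht => ?_⟩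
  · refine isContinuousCurve_mild hη0 hη1 hu₀ (hS.continuousOn_duhamel (hextN W)) fun t ht => ?_
    rw [hmild t ht]
    ext x
    simp [reFun, complexify]
  · simp only
    rw [hmild 0 ⟨le_rfl, hT.le⟩]
    ext x
    simp [reFun, complexify, duhamel, heatFlow_zero]
  · have h1 := (modeEq_iff_mild hη0' hη1' (hext W) hu₀c (hextN W)).2 hmild
    exact (h1.weakEq (hext W) (hextN W)).realWeakEq hg h (hext W) hu₀c
  -- Any solution satisfies the mild equation, so it is the unique fixed point.
  · obtain ⟨⟨hvmem, hvc⟩, -, hveq⟩ := hv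
    have hc : ∀ t ∈ Icc 0 T, Continuous (v t) := fun t ht =>
      continuous_of_mem_holderSpace hη0 (hvmem t ht)
    let V : C(Icc 0 T, C(Torus2, ℂ)) :=
      ⟨fun t => complexify (v t) (hc t t.2), continuous_complexify_curve hc hvc⟩
    have hVt : ∀ t (ht : t ∈ Icc 0 T), V (projIcc 0 T hT.le t) = complexify (v t) (hc t ht) := by
      intro t ht
      rw [projIcc_of_mem hT.le ht]
      rfl
    have h1 := RealWeakEq.weakEq hg h hu₀c hc hVt hveq
    have h2 := (modeEq_iff_mild hη0' hη1' (hext V) hu₀c (hextN V)).1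
      (h1.modeEq (hext V) (hextN V))
    have h3 : V = W := hWu V fun s => by
      have := h2 s s.2
      rwa [projIcc_val] at this
    simp only
    rw [← h3, hVt t ht]
    ext x
    simp [reFun, complexify]
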